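/- For integers $n\ge 1$, $k\ge 0$ and $x\ge 0$ let $v_{k,n}(x)=\binom{n+k-1}{k}x^k(1+x)^{-(n+k)}$ and let $\mathcal V_n f(x)=\sum_{k\ge 0} f(k/n)\,v_{k,n}(x)$ be the Baskakov operator. It is a degree-preserving isomorphism of the space of real polynomials; its inverse on that space can be written in exactly one way as a differential operator $\mathcal U_n=\sum_{k\ge 0}\eta_k^{(n)}D^k$ with polynomial coefficients $\eta_k^{(n)}$, namely $$\eta_k^{(n)}(x)=\sum_{j=0}^k(-1)^j\frac{x^j}{j!}\,\rho_{k-j}(x),\qquad \rho_i(x)=\frac{1}{i!}\,\frac{nx(nx-1)\cdots(nx-i+1)}{n(n+1)\cdots(n+i-1)}.$$ For $s\ge 0$ the Baskakov (left) quasi-interpolant of order $s$ is $$\mathcal V_n^{(s)}f(x)=\sum_{k=0}^{s}\eta_k^{(n)}(x)\,D^k(\mathcal V_nf)(x),\qquad x\ge 0.$$ With $X=x(1+x)$ put $\bar\eta_1=0$, $$\bar\eta_{2m+1}(x)=\frac{(-1)^{m+1}}{3\cdot 2^{m-1}(m-1)!}(1+2x)X^m\quad(m\ge 1),\qquad \bar\eta_{2m}(x)=\frac{(-1)^m}{2^m\,m!}X^m\quad(m\ge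 0).$$ **Theorem 5 (Voronovskaya).** Let $r\ge 0$ be an integer and let $f\in C^{2r+4}(\mathbb R_+)$, $\mathbb R_+=[0,\infty)$, be a real function with $D^{2r+4}f$ bounded on $\mathbb R_+$ (derivatives at $0$ are one-sided). Then for every $n\ge 1$ the series $\mathcal V_nf(x)$ converges absolutely for all $x\ge 0$ and $\mathcal V_nf\in C^{2r+1}(\mathbb R_+)$, so that $\mathcal V_n^{(2r)}f$ and $\mathcal V_n^{(2r+1)}f$ are defined; and for every $x\ge 0$, as $n\to\infty$, $$\lim n^{r+1}\bigl(f(x)-\mathcal V_n^{(2r)}f(x)\bigr)=\bar\eta_{2r+1}(x)\,D^{2r+1}f(x)+\bar\eta_{2r+2}(x)\,D^{2r+2}f(x),$$ $$\lim n^{r+1}\bigl(f(x)-\mathcal V_n^{(2r+1)}f(x)\bigr)=\bar\eta_{2r+2}(x)\,D^{2r+2}f(x).$$ -/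

import Mathlib

noncomputable section

namespace Baskakov

open Polynomial Set
open scoped Nat

/-- The Baskakov basis function
`v_{k,n}(x) = binom(n+k-1, k) x^k (1+x)^{-(n+k)}` (used for `n ≥ 1` and `x ≥ 0`). -/
def basis (n k : ℕ) (x : ℝ) : ℝ :=
  ((n + k - 1).choose k : ℝ) * x ^ k / (1 + x) ^ (n + k)

/-- The Baskakov operator `V_n f (x) = ∑_{k ≥ 0} f(k/n) v_{k,n}(x)`. -/
def op (n : ℕ) (f : ℝ → ℝ) (x : ℝ) : ℝ :=
  ∑' k : ℕ, f ((k : ℝ) / n) * basis n k x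

/-- The polynomial `[nX]_k = nX (nX - 1) ⋯ (nX - k + 1)`. -/
def fallingPoly (n k : ℕ) : ℝ[X] :=
  ∏ i ∈ Finset.range k, (C (n : ℝ) * X - C (i : ℝ))

/-- `ρ_k = [nX]_k / (k! (n)_k)`, where `(n)_k = n (n+1) ⋯ (n+k-1)`. -/
def rho (n k : ℕ) : ℝ[X] :=
  C (1 / ((k ! : ℝ) * (n.ascFactorial k : ℝ))) * fallingPoly n k

/-- The polynomial coefficients `η_k^{(n)}` of the inverse `U_n = ∑_k η_k^{(n)} D^k` of the
Baskakov operator on polynomials, `η_k = ∑_{j=0}^k (-1)^j (X^j / j!) ρ_{k-j}`. That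
`∑_k η_k^{(n)} D^k` is the two-sided inverse of `V_n` on polynomials is proved below, in
`hasSum_diffOp_eta` and `diffOp_eta_eq`; that this determines the `η_k^{(n)}` is
`diffOp_injective`. -/
def eta (n k : ℕ) : ℝ[X] :=
  ∑ j ∈ Finset.range (k + 1), C ((-1 : ℝ) ^ j / (j ! : ℝ)) * X ^ j * rho n (k - j)

/-- The left Baskakov quasi-interpolant
`V_n^{(s)} f (x) = ∑_{k=0}^s η_k^{(n)}(x) D^k (V_n f)(x)`, the derivatives being those of a
function on `[0, ∞)` (one-sided at `0`). -/
def quasiInterpolant (n s : ℕ) (f : ℝ → ℝ) (x : ℝ) : ℝ :=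
  ∑ k ∈ Finset.range (s + 1), (eta n k).eval x * iteratedDerivWithin k (op n f) (Ici 0) x

/-- The limit coefficients `η̄_k`. With `X = x(1+x)`:
`η̄_{2m} = (-1)^m / (2^m m!) X^m`, `η̄_1 = 0`, and, for `m ≥ 1`,
`η̄_{2m+1} = (-1)^{m+1} / (3 · 2^{m-1} (m-1)!) (1+2x) X^m`; note that
`1 / (2^{m-1} (m-1)!) = 2m / (2^m m!)` for `m ≥ 1`, the right side being `0` for `m = 0`. -/
def etaBar (k : ℕ) (x : ℝ) : ℝ :=
  if Even k then
    (-1) ^ (k / 2) / (2 ^ (k / 2) * ((k / 2)! : ℝ)) * (x * (1 + x)) ^ (k / 2)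
  else
    (-1) ^ (k / 2 + 1) * (2 * ((k / 2 : ℕ) : ℝ)) / (3 * 2 ^ (k / 2) * ((k / 2)! : ℝ))
      * (1 + 2 * x) * (x * (1 + x)) ^ (k / 2)

/-- The differential operator `∑_k c_k D^k` on polynomials (a finite sum on each of them). -/
def diffOp (c : ℕ → ℝ[X]) (q : ℝ[X]) : ℝ[X] :=
  ∑ k ∈ Finset.range (q.natDegree + 1), c k * derivative^[k] q

theorem diffOp_eq (c : ℕ → ℝ[X]) (q : ℝ[X]) (N : ℕ) (h : q.natDegree < N) :
    diffOp c q = ∑ k ∈ Finset.range N, c k * derivative^[k] q := by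
  refine Finset.sum_subset (Finset.range_subset_range.2 h) fun k _ hk => ?_
  rw [iterate_derivative_eq_zero (by simpa using hk), mul_zero]

theorem diffOp_add (c : ℕ → ℝ[X]) (p q : ℝ[X]) :
    diffOp c (p + q) = diffOp c p + diffOp c q := by
  have h := natDegree_add_le p q
  rw [diffOp_eq c (p + q) (max p.natDegree q.natDegree + 1) (by omega),
    diffOp_eq c p (max p.natDegree q.natDegree + 1) (by omega),
    diffOp_eq c q (max p.natDegree q.natDegree + 1) (by omega), ← Finset.sum_add_distrib]
  simp [mul_add]

theorem diffOp_C_mul (c : ℕ → ℝ[X]) (a : ℝ) (q : ℝ[X]) :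
    diffOp c (C a * q) = C a * diffOp c q := by
  have h : (C a * q).natDegree < q.natDegree + 1 :=
    Nat.lt_succ_of_le (natDegree_C_mul_le a q)
  rw [diffOp_eq c _ _ h, diffOp, Finset.mul_sum]
  refine Finset.sum_congr rfl fun k _ => ?_
  rw [iterate_derivative_C_mul]
  ring

/-- The coefficients of a differential operator are determined by the operator. -/
theorem diffOp_injective : Function.Injective diffOp := by
  intro c d h
  funext r
  induction r using Nat.strong_induction_on with
  | _ r ih =>
    have h1 := congrFun h (X ^ r)
    rw [diffOp_eq c _ (r + 1) (by simp), diffOp_eq d _ (r + 1) (by simp),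
      Finset.sum_range_succ, Finset.sum_range_succ,
      Finset.sum_congr rfl (fun k hk => by rw [ih k (Finset.mem_range.1 hk)])] at h1
    have h2 := add_left_cancel h1
    refine mul_right_cancel₀ ?_ h2
    rw [iterate_derivative_X_pow_eq_natCast_mul]
    simp [Nat.descFactorial_self, Nat.factorial_ne_zero]

theorem fallingPoly_eval (n k r : ℕ) (hn : 1 ≤ n) :
    (fallingPoly n r).eval ((k : ℝ) / n) = (k.descFactorial r : ℝ) := by
  have hn' : (n : ℝ) ≠ 0 := by positivity
  have h : (fallingPoly n r).eval ((k : ℝ) / n) = ∏ i ∈ Finset.range r, ((k : ℝ) - i) := by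
    rw [fallingPoly, eval_prod]
    refine Finset.prod_congr rfl fun i _ => ?_
    simp only [eval_sub, eval_mul, eval_C, eval_X]
    field_simp
  rw [h]
  clear h
  induction r with
  | zero => simp
  | succ r ih =>
    rw [Finset.prod_range_succ, ih, Nat.descFactorial_succ]
    rcases le_or_gt r k with h | h
    · push_cast [h]
      ring
    · simp [Nat.descFactorial_of_lt h]

theorem hasSum_basis (n : ℕ) (hn : 1 ≤ n) (x : ℝ) (hx : 0 ≤ x) :
    HasSum (fun k => basis n k x) 1 := by
  obtain ⟨m, rfl⟩ : ∃ m, n = m + 1 := ⟨n - 1, by omega⟩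
  have h1 : (0 : ℝ) < 1 + x := by positivity
  have hy : ‖x / (1 + x)‖ < 1 := by
    rw [Real.norm_eq_abs, abs_of_nonneg (by positivity), div_lt_one h1]
    linarith
  have h := (hasSum_choose_mul_geometric_of_norm_lt_one m hy).mul_left ((1 + x) ^ (m + 1))⁻¹
  have e : 1 - x / (1 + x) = (1 + x)⁻¹ := by
    field_simp
    ring
  rw [e] at h
  convert! h using 1
  · funext k
    rw [basis, show m + 1 + k - 1 = k + m by omega, Nat.choose_symm_add, pow_add (1 + x), div_pow]
    field_simp
  · rw [inv_pow, one_div, inv_inv, inv_mul_cancel₀ (by positivity)]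

theorem basis_shift (n r k : ℕ) (hn : 1 ≤ n) (x : ℝ) :
    ((k + r).descFactorial r : ℝ) * basis n (k + r) x
      = (n.ascFactorial r : ℝ) * x ^ r * basis (n + r) k x := by
  obtain ⟨m, rfl⟩ : ∃ m, n = m + 1 := ⟨n - 1, by omega⟩
  have key : (k + r).descFactorial r * (m + 1 + (k + r) - 1).choose (k + r)
      = (m + 1).ascFactorial r * (m + 1 + r + k - 1).choose k := by
    have e1 := Nat.add_choose_mul_factorial_mul_factorial m (k + r)
    have e2 := Nat.add_choose_mul_factorial_mul_factorial (m + r) k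
    have e3 := Nat.factorial_mul_ascFactorial m r
    have e4 := Nat.factorial_mul_descFactorial (show r ≤ k + r by omega)
    rw [Nat.add_sub_cancel] at e4
    rw [show m + 1 + (k + r) - 1 = m + (k + r) by omega,
      show m + 1 + r + k - 1 = m + r + k by omega]
    have e5 : m + (k + r) = m + r + k := by omega
    apply Nat.eq_of_mul_eq_mul_left (Nat.mul_pos k.factorial_pos m.factorial_pos)
    rw [← e4] at e1
    rw [← e3] at e2
    rw [show (m + (k + r))! = (m + r + k)! by rw [e5], ← e2] at e1
    linarith
  have key' : ((k + r).descFactorial r : ℝ) * ((m + 1 + (k + r) - 1).choose (k + r) : ℝ)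
      = ((m + 1).ascFactorial r : ℝ) * ((m + 1 + r + k - 1).choose k : ℝ) := by
    exact_mod_cast key
  rw [basis, basis, show m + 1 + r + k = m + 1 + (k + r) by omega, ← mul_div_assoc, ← mul_div_assoc,
    ← mul_assoc, key', pow_add, show m + 1 + r + k = m + 1 + (k + r) by omega]
  ring

/-- `V_n [n·]_r = (n)_r x^r`. -/
theorem hasSum_fallingPoly (n r : ℕ) (hn : 1 ≤ n) (x : ℝ) (hx : 0 ≤ x) :
    HasSum (fun k : ℕ => (fallingPoly n r).eval ((k : ℝ) / n) * basis n k x)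
      ((n.ascFactorial r : ℝ) * x ^ r) := by
  simp only [fallingPoly_eval _ _ _ hn]
  rw [← hasSum_nat_add_iff' r]
  have h0 : ∑ i ∈ Finset.range r, ((i.descFactorial r : ℕ) : ℝ) * basis n i x = 0 := by
    refine Finset.sum_eq_zero fun i hi => ?_
    rw [Nat.descFactorial_of_lt (Finset.mem_range.1 hi)]
    simp
  rw [h0, sub_zero]
  simp only [basis_shift n r _ hn x]
  simpa using (hasSum_basis (n + r) (by omega) x hx).mul_left ((n.ascFactorial r : ℝ) * x ^ r)

theorem sum_eta (n r : ℕ) :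
    ∑ k ∈ Finset.range (r + 1), eta n k * (C (1 / ((r - k)! : ℝ)) * X ^ (r - k)) = rho n r := by
  set E : PowerSeries ℝ[X] := PowerSeries.mk fun j => C (1 / (j ! : ℝ)) * X ^ j with hE
  set E' : PowerSeries ℝ[X] := PowerSeries.mk fun j => C ((-1 : ℝ) ^ j / (j ! : ℝ)) * X ^ j with hE'
  set R : PowerSeries ℝ[X] := PowerSeries.mk fun j => rho n j with hR
  have hEE : E' * E = 1 := by
    have h := PowerSeries.exp_mul_exp_eq_exp_add (A := ℝ[X]) (-X) X
    have hq : ∀ j : ℕ, algebraMap ℚ ℝ[X] (1 / (j ! : ℚ)) = C (1 / (j ! : ℝ)) := by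
      intro j
      rw [IsScalarTower.algebraMap_apply ℚ ℝ ℝ[X], Polynomial.algebraMap_eq]
      congr 1
      simp
    have h1 : PowerSeries.rescale (X : ℝ[X]) (PowerSeries.exp ℝ[X]) = E := by
      ext1 j
      simp only [hE, PowerSeries.coeff_rescale, PowerSeries.coeff_exp, PowerSeries.coeff_mk, hq]
      ring
    have h2 : PowerSeries.rescale (-X : ℝ[X]) (PowerSeries.exp ℝ[X]) = E' := by
      ext1 j
      simp only [hE', PowerSeries.coeff_rescale, PowerSeries.coeff_exp, PowerSeries.coeff_mk, hq]
      rw [neg_pow, div_eq_mul_one_div ((-1 : ℝ) ^ j), C_mul, C_pow, C_neg, C_1]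
      ring
    rw [h1, h2] at h
    rw [h]
    simp
  have hη : ∀ k, eta n k = PowerSeries.coeff k (E' * R) := by
    intro k
    rw [PowerSeries.coeff_mul, Finset.Nat.sum_antidiagonal_eq_sum_range_succ_mk]
    simp [eta, hE', hR]
  have h3 : ∑ k ∈ Finset.range (r + 1), eta n k * (C (1 / ((r - k)! : ℝ)) * X ^ (r - k))
      = PowerSeries.coeff r (E' * R * E) := by
    rw [PowerSeries.coeff_mul, Finset.Nat.sum_antidiagonal_eq_sum_range_succ_mk]
    refine Finset.sum_congr rfl fun k _ => ?_
    rw [hη k, hE, PowerSeries.coeff_mk]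
  rw [h3, mul_right_comm, hEE, one_mul, hR, PowerSeries.coeff_mk]

/-- `U_n x^r = [nx]_r / (n)_r`. -/
theorem diffOp_eta_X_pow (n r : ℕ) :
    diffOp (eta n) (X ^ r) = C (1 / (n.ascFactorial r : ℝ)) * fallingPoly n r := by
  have h : diffOp (eta n) (X ^ r) = C (r ! : ℝ) * rho n r := by
    rw [← sum_eta, diffOp_eq _ _ (r + 1) (by simp), Finset.mul_sum]
    refine Finset.sum_congr rfl fun k hk => ?_
    have hk' : k ≤ r := by
      have := Finset.mem_range.1 hk
      omega
    have e : (C (r ! : ℝ) : ℝ[X]) * C (1 / ((r - k)! : ℝ)) = (r.descFactorial k : ℝ[X]) := by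
      rw [← C_mul, ← Nat.factorial_mul_descFactorial hk', ← C_eq_natCast]
      have : ((r - k)! : ℝ) ≠ 0 := by positivity
      congr 1
      push_cast
      field_simp
    rw [iterate_derivative_X_pow_eq_natCast_mul, ← e]
    ring
  rw [h, rho, ← mul_assoc, ← C_mul]
  have : (r ! : ℝ) ≠ 0 := by positivity
  congr 2
  rw [one_div, one_div, mul_inv, ← mul_assoc, mul_inv_cancel₀ this, one_mul]

/-- `V_n U_n = id` on polynomials, where `U_n = ∑_k η_k^{(n)} D^k`. -/
theorem hasSum_diffOp_eta (n : ℕ) (hn : 1 ≤ n) (q : ℝ[X]) (x : ℝ) (hx : 0 ≤ x) :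
    HasSum (fun k : ℕ => (diffOp (eta n) q).eval ((k : ℝ) / n) * basis n k x) (q.eval x) := by
  induction q using Polynomial.induction_on' with
  | add p q hp hq =>
    simp only [diffOp_add, eval_add, add_mul]
    exact hp.add hq
  | monomial r a =>
    have hpos : (n.ascFactorial r : ℝ) ≠ 0 := by
      obtain ⟨m, rfl⟩ : ∃ m, n = m + 1 := ⟨n - 1, by omega⟩
      exact_mod_cast (Nat.ascFactorial_pos m r).ne'
    rw [← C_mul_X_pow_eq_monomial, diffOp_C_mul, diffOp_eta_X_pow]
    have h := (hasSum_fallingPoly n r hn x hx).mul_left (a * (1 / (n.ascFactorial r : ℝ)))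
    convert! h using 1
    · funext k
      simp only [eval_mul, eval_C]
      ring
    · simp only [eval_mul, eval_C, eval_pow, eval_X]
      field_simp

theorem exists_diffOp_eta_eq (n : ℕ) (hn : 1 ≤ n) (p : ℝ[X]) : ∃ q, diffOp (eta n) q = p := by
  have hn' : (n : ℝ) ≠ 0 := by positivity
  suffices h : ∀ r, ∃ q, diffOp (eta n) q = p * fallingPoly n r by
    simpa [fallingPoly] using h 0
  induction p using Polynomial.induction_on with
  | C a =>
    intro r
    have hpos : (n.ascFactorial r : ℝ) ≠ 0 := by
      obtain ⟨m, rfl⟩ : ∃ m, n = m + 1 := ⟨n - 1, by omega⟩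
      exact_mod_cast (Nat.ascFactorial_pos m r).ne'
    refine ⟨C (a * (n.ascFactorial r : ℝ)) * X ^ r, ?_⟩
    rw [diffOp_C_mul, diffOp_eta_X_pow, ← mul_assoc, ← C_mul]
    congr 2
    field_simp
  | add p q hp hq =>
    intro r
    obtain ⟨u, hu⟩ := hp r
    obtain ⟨v, hv⟩ := hq r
    exact ⟨u + v, by rw [diffOp_add, hu, hv, add_mul]⟩
  | monomial k a ih =>
    intro r
    obtain ⟨u, hu⟩ := ih (r + 1)
    obtain ⟨v, hv⟩ := ih r
    refine ⟨C (n : ℝ)⁻¹ * (u + C (r : ℝ) * v), ?_⟩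
    rw [diffOp_C_mul, diffOp_add, diffOp_C_mul, hu, hv, fallingPoly, fallingPoly,
      Finset.prod_range_succ]
    have e : (C (n : ℝ)⁻¹ : ℝ[X]) * C (n : ℝ) = 1 := by
      rw [← C_mul, inv_mul_cancel₀ hn', C_1]
    linear_combination (C a * X ^ (k + 1) * ∏ i ∈ Finset.range r, (C (n : ℝ) * X - C (i : ℝ))) * e

/-- `U_n V_n = id` on polynomials: `V_n p` agrees on `[0, ∞)` with exactly one polynomial `q`,
and `∑_k η_k^{(n)} D^k q = p`. -/
theorem diffOp_eta_eq (n : ℕ) (hn : 1 ≤ n) (p : ℝ[X]) :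
    (∃! q : ℝ[X], ∀ x : ℝ, 0 ≤ x → op n (fun t => p.eval t) x = q.eval x) ∧
      ∀ q : ℝ[X], (∀ x : ℝ, 0 ≤ x → op n (fun t => p.eval t) x = q.eval x) →
        diffOp (eta n) q = p := by
  obtain ⟨q, rfl⟩ := exists_diffOp_eta_eq n hn p
  have h1 : ∀ x : ℝ, 0 ≤ x → op n (fun t => (diffOp (eta n) q).eval t) x = q.eval x :=
    fun x hx => (hasSum_diffOp_eta n hn q x hx).tsum_eq
  have h2 : ∀ q' : ℝ[X],
      (∀ x : ℝ, 0 ≤ x → op n (fun t => (diffOp (eta n) q).eval t) x = q'.eval x) → q' = q := by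
    intro q' h
    refine Polynomial.eq_of_infinite_eval_eq q' q ((Ici_infinite (0 : ℝ)).mono fun x hx => ?_)
    exact (h x hx).symm.trans (h1 x hx)
  exact ⟨⟨q, h1, h2⟩, fun q' h => by rw [h2 q' h]⟩

end Baskakov

end

/-!
Fix `x` and let `p` be the Taylor polynomial of `f` of degree `2r + 3` at `x`. Since
`U_n V_n p = p` and `V_n p` has degree at most `2r + 3`,

`f(x) - V_n^{(s)} f (x)
  = ∑_{s < k ≤ 2r+3} η_k(x) D^k (V_n p)(x) - ∑_{k ≤ s} η_k(x) D^k (V_n (f - p))(x)`.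

Three asymptotic facts give the limits after multiplication by `n^{r+1}`.

* `n^{⌈k/2⌉} η_k → η̄_k` (`tendsto_eta`), by a three-term recurrence for `η_k` that comes from
  Kummer's differential equation for the generating function (`eta_succ_succ_eval`). In the first
  sum only `k = 2r + 1` and `k = 2r + 2` survive.
* `D^k (V_n p)(x) → D^k f(x)` (`tendsto_iterate_derivative_taylorImage`). The polynomials
  `V_n (t - c)^i` satisfy a first-order recurrence in `i`, from
  `x(1+x) v_{k,n}' = (k - nx) v_{k,n}`; it yields this limit together with the bounds on central moments.
* `D^k (V_n (f - p))(x) = O(n^{-(r + 2) + ⌈k/2⌉})` for `k ≤ 2r + 1`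
  (`exists_iteratedDerivWithin_series_bound`). Differentiating a Baskakov series takes forward
  differences of its coefficients (`PolyGrowth.hasDerivAt_series`); the `k`-th differences of
  `f - p` at a node `t` are `O(n^{-k})` times `|t - x|^{2r+4-k}`, up to a shift of order `1/n`, and
  their average is a central moment. With the order of `η_k` the second sum is `O(n^{-(r+2)})`.

The derivative formula also gives the smoothness of `V_n f`: its coefficients grow polynomially
while the basis decays geometrically, so all series converge locally uniformly near `[0, ∞)`.
-/

namespace Baskakov

open Polynomial Set Filter Topology
open scoped Nat

/-! ### The coefficients `η_k` -/

theorem rho_succ_eval (n i : ℕ) (hn : 1 ≤ n) (x : ℝ) :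
    ((i : ℝ) + 1) * (n + i) * (rho n (i + 1)).eval x = (n * x - i) * (rho n i).eval x := by
  have h1 : (n.ascFactorial i : ℝ) ≠ 0 := by
    obtain ⟨m, rfl⟩ : ∃ m, n = m + 1 := ⟨n - 1, by omega⟩
    exact_mod_cast (Nat.ascFactorial_pos m i).ne'
  have h2 : ((n : ℝ) + i) ≠ 0 := by positivity
  have h3 : (i ! : ℝ) ≠ 0 := by positivity
  simp only [rho, fallingPoly, Finset.prod_range_succ, Nat.ascFactorial_succ, Nat.factorial_succ,
    eval_mul, eval_C, eval_sub, eval_X]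
  push_cast
  field_simp

/-- The three-term recurrence for `η_k`. The generating function `F(t) = ∑ ρ_i t^i` is the
confluent hypergeometric function `₁F₁(-nx; n; -t)`, so it solves Kummer's equation
`t F'' + (n + t) F' - n x F = 0`; hence `G = e^{-xt} F = ∑ η_k t^k` solves
`t G'' + (n + (1 + 2x) t) G' + x (1 + x) t G = 0`, and the recurrence compares coefficients. -/
theorem eta_succ_succ_eval (n k : ℕ) (hn : 1 ≤ n) (x : ℝ) :
    ((k : ℝ) + 2) * (n + k + 1) * (eta n (k + 2)).eval x
      = -((1 + 2 * x) * (k + 1) * (eta n (k + 1)).eval x) - x * (1 + x) * (eta n k).eval x := by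
  set E : PowerSeries ℝ := PowerSeries.mk fun j => (-1 : ℝ) ^ j / (j ! : ℝ) * x ^ j with hE
  set F : PowerSeries ℝ := PowerSeries.mk fun j => (rho n j).eval x with hF
  set G : PowerSeries ℝ := PowerSeries.mk fun j => (eta n j).eval x with hG
  let d := PowerSeries.derivative ℝ
  have hEF : G = E * F := by
    ext k
    rw [PowerSeries.coeff_mul, Finset.Nat.sum_antidiagonal_eq_sum_range_succ_mk]
    simp [hG, hE, hF, eta, eval_finsetSum]
  have hdE : d E = -PowerSeries.C x * E := by
    ext k
    rw [PowerSeries.coeff_derivative, ← map_neg, PowerSeries.coeff_C_mul]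
    simp only [hE, PowerSeries.coeff_mk, Nat.factorial_succ]
    push_cast
    field_simp
    ring
  have hdF : PowerSeries.X * d (d F) + (PowerSeries.C (n : ℝ) + PowerSeries.X) * d F
      - PowerSeries.C ((n : ℝ) * x) * F = 0 := by
    ext i
    have h := rho_succ_eval n i hn x
    rcases i with _ | i
    · simp only [map_sub, map_add, add_mul, PowerSeries.coeff_C_mul, PowerSeries.coeff_zero_X_mul,
        d, PowerSeries.coeff_derivative, map_zero, hF, PowerSeries.coeff_mk]
      push_cast at h ⊢
      linarith
    · simp only [map_sub, map_add, add_mul, PowerSeries.coeff_C_mul, PowerSeries.coeff_succ_X_mul,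
        d, PowerSeries.coeff_derivative, map_zero, hF, PowerSeries.coeff_mk]
      push_cast at h ⊢
      linarith
  have hdG : PowerSeries.X * d (d G)
      + (PowerSeries.C (n : ℝ) + PowerSeries.C (1 + 2 * x) * PowerSeries.X) * d G
      + PowerSeries.C (x * (1 + x)) * (PowerSeries.X * G) = 0 := by
    have h1 : d G = E * d F - PowerSeries.C x * G := by
      rw [hEF, Derivation.leibniz, hdE, smul_eq_mul, smul_eq_mul]
      ring
    have hC : d (PowerSeries.C x) = 0 := PowerSeries.derivative_C
    have h2 : d (d G) = E * d (d F) - 2 * PowerSeries.C x * (E * d F)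
        + PowerSeries.C x * (PowerSeries.C x * G) := by
      rw [h1, map_sub, Derivation.leibniz, Derivation.leibniz, hdE, hC, h1]
      simp only [smul_eq_mul]
      ring
    rw [h2, h1, hEF]
    simp only [map_mul, map_add, map_one, map_ofNat] at hdF ⊢
    linear_combination E * hdF
  have h := congrArg (PowerSeries.coeff (k + 1)) hdG
  simp only [map_add, add_mul, mul_assoc, PowerSeries.coeff_C_mul, PowerSeries.coeff_succ_X_mul,
    d, PowerSeries.coeff_derivative, map_zero, hG, PowerSeries.coeff_mk] at h
  push_cast at h
  linarith

theorem eta_zero_eval (n : ℕ) (x : ℝ) : (eta n 0).eval x = 1 := by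
  simp [eta, rho, fallingPoly]

theorem eta_one_eval (n : ℕ) (hn : 1 ≤ n) (x : ℝ) : (eta n 1).eval x = 0 := by
  have : (n : ℝ) ≠ 0 := by positivity
  simp [eta, rho, fallingPoly, Finset.sum_range_succ, Nat.ascFactorial]
  field_simp
  ring

/-- `η_k^{(n)}` has order `n^{-⌈k/2⌉}`, with leading coefficient `η̄_k`; the odd coefficients are
one half order smaller than the scaling `n^{-k/2}` suggests. -/
theorem tendsto_eta (x : ℝ) (k : ℕ) :
    Tendsto (fun n : ℕ => (n : ℝ) ^ ((k + 1) / 2) * (eta n k).eval x) atTop (𝓝 (etaBar k x)) := by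
  have hratio : ∀ k : ℕ, Tendsto (fun n : ℕ => (n : ℝ) / (n + k + 1)) atTop (𝓝 1) := by
    intro k
    have := tendsto_natCast_div_add_atTop (𝕜 := ℝ) ((k : ℝ) + 1)
    simpa [add_assoc] using this
  have hinv : Tendsto (fun n : ℕ => (n : ℝ)⁻¹) atTop (𝓝 0) := tendsto_inv_atTop_nhds_zero_nat
  have hstep : ∀ (n k e : ℕ), 1 ≤ n → (n : ℝ) ^ (e + 1) * (eta n (k + 2)).eval x
      = (n : ℝ) / (n + k + 1) * ((-((1 + 2 * x) * (k + 1) * ((n : ℝ) ^ e * (eta n (k + 1)).eval x))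
        - x * (1 + x) * ((n : ℝ) ^ e * (eta n k).eval x)) / (k + 2)) := by
    intro n k e hn
    have h := eta_succ_succ_eval n k hn x
    have h1 : ((n : ℝ) + k + 1) ≠ 0 := by positivity
    have h2 : ((k : ℝ) + 2) ≠ 0 := by positivity
    field_simp
    linear_combination (n : ℝ) ^ (e + 1) * h
  have key : ∀ m : ℕ,
      Tendsto (fun n : ℕ => (n : ℝ) ^ m * (eta n (2 * m)).eval x) atTop (𝓝 (etaBar (2 * m) x)) ∧
      Tendsto (fun n : ℕ => (n : ℝ) ^ (m + 1) * (eta n (2 * m + 1)).eval x) atTop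
        (𝓝 (etaBar (2 * m + 1) x)) := by
    intro m
    induction m with
    | zero =>
      refine ⟨by simp [eta_zero_eval, etaBar], ?_⟩
      have : etaBar (2 * 0 + 1) x = 0 := by simp [etaBar]
      rw [this]
      refine tendsto_const_nhds.congr' ?_
      filter_upwards [eventually_ge_atTop 1] with n hn
      simp [eta_one_eval n hn]
    | succ m ih =>
      obtain ⟨h0, h1⟩ := ih
      -- the odd coefficient drops out of the limit of the next even one
      have h1' : Tendsto (fun n : ℕ => (n : ℝ) ^ m * (eta n (2 * m + 1)).eval x) atTop (𝓝 0) := by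
        have := hinv.mul h1
        rw [zero_mul] at this
        refine this.congr' ?_
        filter_upwards [eventually_ge_atTop 1] with n hn
        have : (n : ℝ) ≠ 0 := by positivity
        field_simp
        ring
      have h2 : Tendsto (fun n : ℕ => (n : ℝ) ^ (m + 1) * (eta n (2 * m + 2)).eval x) atTop
          (𝓝 (etaBar (2 * (m + 1)) x)) := by
        have := (hratio (2 * m)).mul (((h1'.const_mul ((1 + 2 * x) * ((2 * m : ℕ) + 1))).neg.sub
          (h0.const_mul (x * (1 + x)))).div_const (((2 * m : ℕ) : ℝ) + 2))
        have e : (1 : ℝ) * ((-((1 + 2 * x) * (((2 * m : ℕ) : ℝ) + 1) * 0)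
            - x * (1 + x) * etaBar (2 * m) x) / (((2 * m : ℕ) : ℝ) + 2))
            = etaBar (2 * (m + 1)) x := by
          simp only [etaBar, even_two_mul, if_true, Nat.mul_div_cancel_left _ two_pos,
            Nat.factorial_succ]
          push_cast
          field_simp
          ring
        rw [e] at this
        refine this.congr' ?_
        filter_upwards [eventually_ge_atTop 1] with n hn
        exact (hstep n (2 * m) m hn).symm
      refine ⟨h2, ?_⟩
      have := (hratio (2 * m + 1)).mul (((h2.const_mul
        ((1 + 2 * x) * ((2 * m + 1 : ℕ) + 1))).neg.sub
          (h1.const_mul (x * (1 + x)))).div_const (((2 * m + 1 : ℕ) : ℝ) + 2))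
      have e : (1 : ℝ) * ((-((1 + 2 * x) * (((2 * m + 1 : ℕ) : ℝ) + 1) * etaBar (2 * (m + 1)) x)
          - x * (1 + x) * etaBar (2 * m + 1) x) / (((2 * m + 1 : ℕ) : ℝ) + 2))
          = etaBar (2 * (m + 1) + 1) x := by
        have o1 : ∀ m : ℕ, ¬ Even (2 * m + 1) := fun m => by simp
        have o2 : ∀ m : ℕ, (2 * m + 1) / 2 = m := fun m => by omega
        simp only [etaBar, even_two_mul, if_true, o1, if_false, o2,
          Nat.mul_div_cancel_left _ two_pos, Nat.factorial_succ]
        push_cast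
        field_simp
        ring
      rw [e] at this
      refine this.congr' ?_
      filter_upwards [eventually_ge_atTop 1] with n hn
      exact (hstep n (2 * m + 1) (m + 1) hn).symm
  rcases Nat.even_or_odd' k with ⟨m, rfl | rfl⟩
  · rw [show (2 * m + 1) / 2 = m by omega]
    exact (key m).1
  · rw [show (2 * m + 1 + 1) / 2 = m + 1 by omega]
    exact (key m).2

/-! ### Series in the Baskakov basis and their derivatives -/

/-- A real sequence bounded by a polynomial in its index. -/
def PolyGrowth (a : ℕ → ℝ) : Prop :=
  ∃ (C : ℝ) (d : ℕ), ∀ k : ℕ, |a k| ≤ C * ((k : ℝ) + 1) ^ d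

/-- The series `∑_k a_k v_{k,n}(x)`; thus `op n f = series n (fun k => f (k / n))`. -/
noncomputable def series (n : ℕ) (a : ℕ → ℝ) (x : ℝ) : ℝ :=
  ∑' k : ℕ, a k * basis n k x

theorem PolyGrowth.mono_exponent {a : ℕ → ℝ} {C : ℝ} {d e : ℕ}
    (h : ∀ k : ℕ, |a k| ≤ C * ((k : ℝ) + 1) ^ d) (hde : d ≤ e) (k : ℕ) :
    |a k| ≤ C * ((k : ℝ) + 1) ^ e := by
  have hC : 0 ≤ C := by simpa using (abs_nonneg _).trans (h 0)
  exact (h k).trans (mul_le_mul_of_nonneg_left (pow_le_pow_right₀ (by simp) hde) hC)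

theorem PolyGrowth.add {a b : ℕ → ℝ} (ha : PolyGrowth a) (hb : PolyGrowth b) :
    PolyGrowth (fun k => a k + b k) := by
  obtain ⟨C, d, ha⟩ := ha
  obtain ⟨D, e, hb⟩ := hb
  refine ⟨C + D, max d e, fun k => (abs_add_le _ _).trans ?_⟩
  rw [add_mul]
  exact add_le_add (PolyGrowth.mono_exponent ha (le_max_left _ _) k)
    (PolyGrowth.mono_exponent hb (le_max_right _ _) k)

theorem PolyGrowth.const_mul {a : ℕ → ℝ} (ha : PolyGrowth a) (c : ℝ) :
    PolyGrowth (fun k => c * a k) := by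
  obtain ⟨C, d, ha⟩ := ha
  refine ⟨|c| * C, d, fun k => ?_⟩
  rw [abs_mul, mul_assoc]
  exact mul_le_mul_of_nonneg_left (ha k) (abs_nonneg c)

theorem PolyGrowth.sum {ι : Type*} (s : Finset ι) {a : ι → ℕ → ℝ}
    (ha : ∀ i ∈ s, PolyGrowth (a i)) : PolyGrowth (fun k => ∑ i ∈ s, a i k) := by
  classical
  induction s using Finset.induction_on with
  | empty => exact ⟨0, 0, fun k => by simp⟩
  | insert i s hi ih =>
    simp only [Finset.sum_insert hi]
    exact (ha i (Finset.mem_insert_self i s)).add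
      (ih fun j hj => ha j (Finset.mem_insert_of_mem hj))

theorem PolyGrowth.shift {a : ℕ → ℝ} (ha : PolyGrowth a) : PolyGrowth (fun k => a (k + 1)) := by
  obtain ⟨C, d, ha⟩ := ha
  have hC : 0 ≤ C := by simpa using (abs_nonneg _).trans (ha 0)
  refine ⟨C * 2 ^ d, d, fun k => (ha (k + 1)).trans ?_⟩
  rw [mul_assoc, ← mul_pow]
  refine mul_le_mul_of_nonneg_left (pow_le_pow_left₀ (by positivity) ?_ d) hC
  push_cast
  linarith [(Nat.cast_nonneg k : (0 : ℝ) ≤ k)]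

theorem PolyGrowth.fwdDiff {a : ℕ → ℝ} (ha : PolyGrowth a) : PolyGrowth (fwdDiff 1 a) := by
  have := ha.shift.add (ha.const_mul (-1))
  refine (congrArg PolyGrowth ?_).mp this
  funext k
  simp only [_root_.fwdDiff]
  ring

theorem PolyGrowth.fwdDiff_iter {a : ℕ → ℝ} (ha : PolyGrowth a) (m : ℕ) :
    PolyGrowth ((_root_.fwdDiff 1)^[m] a) := by
  induction m with
  | zero => exact ha
  | succ m ih =>
    rw [Function.iterate_succ_apply']
    exact ih.fwdDiff

theorem polyGrowth_node_sub_pow (n : ℕ) (hn : 1 ≤ n) (c : ℝ) (i : ℕ) :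
    PolyGrowth (fun k : ℕ => ((k : ℝ) / n - c) ^ i) := by
  refine ⟨(1 + |c|) ^ i, i, fun k => ?_⟩
  rw [abs_pow, ← mul_pow]
  refine pow_le_pow_left₀ (abs_nonneg _) ((abs_sub _ _).trans ?_) i
  have h1 : (k : ℝ) / n ≤ k := div_le_self (by positivity) (by exact_mod_cast hn)
  have h2 : 0 ≤ (k : ℝ) / n := by positivity
  have h3 : (0 : ℝ) ≤ k := by positivity
  rw [abs_of_nonneg h2]
  nlinarith [abs_nonneg c]

/-- Locally uniform geometric decay of the Baskakov basis. A two-sided neighbourhood of `0`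
is covered, since `|x / (1 + x)| ≤ 1/3` for `-1/4 ≤ x ≤ 0`. -/
theorem exists_basis_bound (n : ℕ) (hn : 1 ≤ n) {R : ℝ} (hR : 0 < R) :
    ∃ B q : ℝ, 0 ≤ B ∧ 0 < q ∧ q < 1 ∧
      ∀ k : ℕ, ∀ x ∈ Ioo (-(1 / 4) : ℝ) R, |basis n k x| ≤ B * ((k : ℝ) + 1) ^ n * q ^ k := by
  have hR1 : 0 < 1 + R := by positivity
  refine ⟨(4 / 3) ^ n * ((n : ℝ) + 1) ^ n, max (1 / 3) (R / (1 + R)), by positivity,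
    lt_max_of_lt_left (by norm_num), max_lt (by norm_num) ((div_lt_one hR1).2 (by linarith)), ?_⟩
  rintro k x ⟨hx1, hx2⟩
  have h1 : 0 < 1 + x := by linarith
  have hq : |x / (1 + x)| ≤ max (1 / 3) (R / (1 + R)) := by
    rw [abs_le]
    constructor
    · have : -(1 / 3) ≤ x / (1 + x) := by
        rw [le_div_iff₀ h1]
        linarith
      linarith [le_max_left (1 / 3) (R / (1 + R))]
    · refine le_max_of_le_right ?_
      rw [div_le_div_iff₀ h1 hR1]
      nlinarith
  have hchoose : ((n + k - 1).choose k : ℝ) ≤ ((n : ℝ) + 1) ^ n * ((k : ℝ) + 1) ^ n := by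
    have h2 : (n + k - 1).choose k ≤ ((n + 1) * (k + 1)) ^ n := by
      obtain ⟨m, rfl⟩ : ∃ m, n = m + 1 := ⟨n - 1, by omega⟩
      rw [show m + 1 + k - 1 = k + m by omega, Nat.choose_symm_add]
      calc (k + m).choose m ≤ (k + m) ^ m := Nat.choose_le_pow _ _
        _ ≤ ((m + 1 + 1) * (k + 1)) ^ m := Nat.pow_le_pow_left (by nlinarith) m
        _ ≤ ((m + 1 + 1) * (k + 1)) ^ (m + 1) := Nat.pow_le_pow_right (by positivity) (by omega)
    rw [← mul_pow]
    exact_mod_cast h2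
  have e : basis n k x
      = ((1 + x)⁻¹) ^ n * ((n + k - 1).choose k : ℝ) * (x / (1 + x)) ^ k := by
    rw [basis, pow_add, div_pow, inv_pow]
    field_simp
  have h3 : (1 + x)⁻¹ ≤ 4 / 3 := by
    rw [inv_le_comm₀ h1 (by norm_num)]
    linarith
  rw [e, abs_mul, abs_mul, abs_pow, abs_pow, Nat.abs_cast, abs_of_nonneg (inv_nonneg.2 h1.le),
    mul_assoc ((4 / 3 : ℝ) ^ n)]
  gcongr

theorem summable_succ_pow_mul_geometric (d : ℕ) {q : ℝ} (h0 : 0 < q) (h1 : q < 1) :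
    Summable fun k : ℕ => ((k : ℝ) + 1) ^ d * q ^ k := by
  have h := summable_pow_mul_geometric_of_norm_lt_one d
    (show ‖q‖ < 1 by rwa [Real.norm_of_nonneg h0.le])
  have h2 := ((summable_nat_add_iff 1).2 h).mul_left q⁻¹
  refine h2.congr fun k => ?_
  push_cast
  field_simp
  ring

/-- The majorant of `exists_basis_bound` is summable against sequences of polynomial growth. -/
theorem PolyGrowth.summable_mul_bound {a : ℕ → ℝ} (ha : PolyGrowth a) (n : ℕ) (B : ℝ) {q : ℝ}
    (h0 : 0 < q) (h1 : q < 1) :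
    Summable fun k : ℕ => |a k| * (B * ((k : ℝ) + 1) ^ n * q ^ k) := by
  obtain ⟨C, d, ha⟩ := ha
  refine Summable.of_norm_bounded
    ((summable_succ_pow_mul_geometric (d + n) h0 h1).mul_left (C * |B|)) fun k => ?_
  have : (0 : ℝ) ≤ (k : ℝ) + 1 := by positivity
  rw [Real.norm_eq_abs, abs_mul, abs_mul, abs_mul, abs_abs, abs_of_nonneg (pow_nonneg this n),
    abs_of_nonneg (pow_nonneg h0.le k)]
  calc |a k| * (|B| * ((k : ℝ) + 1) ^ n * q ^ k)
      ≤ (C * ((k : ℝ) + 1) ^ d) * (|B| * ((k : ℝ) + 1) ^ n * q ^ k) := by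
        gcongr
        exact ha k
    _ = _ := by ring

theorem PolyGrowth.summable_abs {a : ℕ → ℝ} (ha : PolyGrowth a) (n : ℕ) (hn : 1 ≤ n) {x : ℝ}
    (hx : -(1 / 4) < x) : Summable fun k : ℕ => |a k * basis n k x| := by
  obtain ⟨B, q, -, hq0, hq1, h⟩ := exists_basis_bound n hn (R := |x| + 1) (by positivity)
  refine Summable.of_nonneg_of_le (fun k => abs_nonneg _) (fun k => ?_)
    (ha.summable_mul_bound n B hq0 hq1)
  rw [abs_mul]
  exact mul_le_mul_of_nonneg_left (h k x ⟨hx, by linarith [le_abs_self x]⟩) (abs_nonneg _)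

theorem PolyGrowth.summable {a : ℕ → ℝ} (ha : PolyGrowth a) (n : ℕ) (hn : 1 ≤ n) {x : ℝ}
    (hx : -(1 / 4) < x) : Summable fun k : ℕ => a k * basis n k x :=
  (ha.summable_abs n hn hx).of_abs

/-- `v_{k-1,n}`, with the convention `v_{-1,n} = 0`. -/
noncomputable def basisPred (n k : ℕ) (x : ℝ) : ℝ :=
  if k = 0 then 0 else basis n (k - 1) x

theorem hasDerivAt_basis (n k : ℕ) (hn : 1 ≤ n) {x : ℝ} (hx : -(1 / 4) < x) :
    HasDerivAt (basis n k) (n * (basisPred (n + 1) k x - basis (n + 1) k x)) x := by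
  have h1 : (1 + x) ≠ 0 := by linarith
  have hd := (((hasDerivAt_pow k x).const_mul ((n + k - 1).choose k : ℝ)).div
    (((hasDerivAt_id x).const_add 1).pow (n + k)) (pow_ne_zero _ h1))
  refine hd.congr_deriv ?_
  rcases k with _ | k
  · obtain ⟨m, rfl⟩ : ∃ m, n = m + 1 := ⟨n - 1, by omega⟩
    simp [basisPred, basis]
    field_simp
    ring
  · obtain ⟨m, rfl⟩ : ∃ m, n = m + 1 := ⟨n - 1, by omega⟩
    have e1 : ((m + 1 + k).choose (k + 1) : ℝ) * (k + 1)
        = ((m + 1 + k).choose k : ℝ) * (m + 1) := by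
      have := Nat.choose_succ_right_eq (m + 1 + k) k
      rw [show m + 1 + k - k = m + 1 by omega] at this
      exact_mod_cast this
    have e2 : ((m + 1 + k).choose (k + 1) : ℝ) * (m + 1 + k + 1)
        = ((m + 1 + k + 1).choose (k + 1) : ℝ) * (m + 1) := by
      have := Nat.choose_mul_succ_eq (m + 1 + k) (k + 1)
      rw [show m + 1 + k + 1 - (k + 1) = m + 1 by omega] at this
      exact_mod_cast this
    simp only [basisPred, basis, Nat.add_sub_cancel, Nat.succ_ne_zero, if_false, id,
      show m + 1 + (k + 1) - 1 = m + 1 + k by omega,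
      show m + 1 + 1 + k - 1 = m + 1 + k by omega,
      show m + 1 + 1 + (k + 1) - 1 = m + 1 + k + 1 by omega]
    rw [show m + 1 + (k + 1) = m + k + 2 by omega, show m + 1 + 1 + k = m + k + 2 by omega,
      show m + 1 + 1 + (k + 1) = m + k + 3 by omega]
    push_cast
    simp only [pow_succ, Pi.pow_apply]
    field_simp
    linear_combination x ^ k * (1 + x) ^ k * (1 + x) ^ m * ((1 + x) ^ 2 * e1 - x * (1 + x) * e2)

/-- `x(1+x) v_{k,n}'(x) = (k - n x) v_{k,n}(x)`. -/
theorem basis_deriv_mul (n k : ℕ) (hn : 1 ≤ n) {x : ℝ} (hx : -(1 / 4) < x) :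
    x * (1 + x) * (n * (basisPred (n + 1) k x - basis (n + 1) k x))
      = (k - n * x) * basis n k x := by
  have h1 : (1 + x) ≠ 0 := by linarith
  have hd := (((hasDerivAt_pow k x).const_mul ((n + k - 1).choose k : ℝ)).div
    (((hasDerivAt_id x).const_add 1).pow (n + k)) (pow_ne_zero _ h1))
  rw [(hasDerivAt_basis n k hn hx).unique hd]
  obtain ⟨m, rfl⟩ : ∃ m, n = m + 1 := ⟨n - 1, by omega⟩
  rcases k with _ | k
  · simp [basis]
    field_simp
    ring
  · simp only [basis, id, show m + 1 + (k + 1) = m + k + 2 by omega, Pi.pow_apply,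
      Nat.add_sub_cancel, show m + k + 2 - 1 = m + k + 1 by omega]
    push_cast
    simp only [pow_succ]
    field_simp
    ring

/-- Termwise differentiation of a series in the Baskakov basis. -/
theorem PolyGrowth.hasDerivAt_series_tsum {a : ℕ → ℝ} (ha : PolyGrowth a) (n : ℕ) (hn : 1 ≤ n)
    {x : ℝ} (hx : -(1 / 4) < x) :
    HasDerivAt (series n a)
      (∑' k, a k * (n * (basisPred (n + 1) k x - basis (n + 1) k x))) x := by
  obtain ⟨B, q, hB, hq0, hq1, h⟩ := exists_basis_bound (n + 1) (by omega) (R := |x| + 1)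
    (by positivity)
  set U : ℕ → ℝ := fun k => B * ((k : ℝ) + 1) ^ (n + 1) * q ^ k with hU
  have hU0 : ∀ k, 0 ≤ U k := fun k => by positivity
  have hs1 : Summable fun k : ℕ => |a k| * U k := ha.summable_mul_bound (n + 1) B hq0 hq1
  have hs2 : Summable fun k : ℕ => |a k| * U (k - 1) :=
    (summable_nat_add_iff 1).1 (ha.shift.summable_mul_bound (n + 1) B hq0 hq1)
  refine hasDerivAt_tsum_of_isPreconnected (u := fun k => n * (|a k| * U (k - 1) + |a k| * U k))
    (t := Ioo (-(1 / 4)) (|x| + 1)) ((hs2.add hs1).mul_left _) isOpen_Ioo isPreconnected_Ioo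
    (g := fun k y => a k * basis n k y)
    (g' := fun k y => a k * (n * (basisPred (n + 1) k y - basis (n + 1) k y)))
    (fun k y hy => (hasDerivAt_basis n k hn hy.1).const_mul (a k)) ?_
    (y₀ := x) ⟨hx, by linarith [le_abs_self x]⟩ (ha.summable n hn hx)
    ⟨hx, by linarith [le_abs_self x]⟩
  intro k y hy
  have hp : |basisPred (n + 1) k y| ≤ U (k - 1) := by
    rw [basisPred]
    split_ifs with hk
    · simpa using hU0 _
    · exact h _ y hy
  rw [Real.norm_eq_abs, abs_mul, abs_mul, Nat.abs_cast]
  calc |a k| * (n * |basisPred (n + 1) k y - basis (n + 1) k y|)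
      ≤ |a k| * (n * (U (k - 1) + U k)) := by
        gcongr
        exact (abs_sub _ _).trans (add_le_add hp (h k y hy))
    _ = _ := by ring

/-- The termwise derivative of a Baskakov series, summed by parts. -/
theorem PolyGrowth.hasSum_deriv {a : ℕ → ℝ} (ha : PolyGrowth a) (n : ℕ)
    {x : ℝ} (hx : -(1 / 4) < x) :
    HasSum (fun k => a k * (n * (basisPred (n + 1) k x - basis (n + 1) k x)))
      (n * series (n + 1) (_root_.fwdDiff 1 a) x) := by
  have hs := ha.summable (n + 1) (by omega) hx
  have hs' := ha.shift.summable (n + 1) (by omega) hx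
  have h1 : HasSum (fun k => a k * basisPred (n + 1) k x)
      (∑' k, a (k + 1) * basis (n + 1) k x) := by
    rw [← hasSum_nat_add_iff' 1]
    simpa [basisPred] using hs'.hasSum
  have h2 := (h1.sub hs.hasSum).mul_left (n : ℝ)
  have e : series (n + 1) (_root_.fwdDiff 1 a) x
      = ∑' k, a (k + 1) * basis (n + 1) k x - ∑' k, a k * basis (n + 1) k x := by
    rw [← hs'.tsum_sub hs]
    simp only [series, _root_.fwdDiff, sub_mul]
  rw [e]
  refine h2.congr_fun ?_
  intro k
  ring

/-- Differentiation of a series in the Baskakov basis takes forward differences of its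
coefficients and raises `n` by one. -/
theorem PolyGrowth.hasDerivAt_series {a : ℕ → ℝ} (ha : PolyGrowth a) (n : ℕ) (hn : 1 ≤ n)
    {x : ℝ} (hx : -(1 / 4) < x) :
    HasDerivAt (series n a) (n * series (n + 1) (_root_.fwdDiff 1 a) x) x := by
  rw [← (ha.hasSum_deriv n hx).tsum_eq]
  exact ha.hasDerivAt_series_tsum n hn hx

theorem PolyGrowth.hasSum_mul_sub {a : ℕ → ℝ} (ha : PolyGrowth a) (n : ℕ) (hn : 1 ≤ n)
    {x : ℝ} (hx : -(1 / 4) < x) :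
    HasSum (fun k : ℕ => a k * ((k - n * x) * basis n k x))
      (x * (1 + x) * (n * series (n + 1) (_root_.fwdDiff 1 a) x)) := by
  refine ((ha.hasSum_deriv n hx).mul_left (x * (1 + x))).congr_fun fun k => ?_
  rw [← basis_deriv_mul n k hn hx]
  ring

theorem PolyGrowth.iteratedDerivWithin_series {a : ℕ → ℝ} (ha : PolyGrowth a) (n : ℕ) (hn : 1 ≤ n)
    (k : ℕ) :
    EqOn (iteratedDerivWithin k (series n a) (Ici 0))
      (fun x => (n.ascFactorial k : ℝ) * series (n + k) ((_root_.fwdDiff 1)^[k] a) x) (Ici 0) := by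
  induction k with
  | zero => intro x _; simp
  | succ k ih =>
    intro x hx
    have hx0 : (0 : ℝ) ≤ x := hx
    rw [iteratedDerivWithin_succ, derivWithin_congr ih (ih hx)]
    have h := (((ha.fwdDiff_iter k).hasDerivAt_series (n + k) (by omega)
      (x := x) (by linarith)).const_mul (n.ascFactorial k : ℝ)).hasDerivWithinAt (s := Ici 0)
    rw [h.derivWithin (uniqueDiffOn_Ici 0 x hx), Nat.ascFactorial_succ,
      Function.iterate_succ_apply']
    push_cast
    simp only [add_assoc]
    ring

theorem PolyGrowth.contDiffOn_series {a : ℕ → ℝ} (ha : PolyGrowth a) (n : ℕ) (hn : 1 ≤ n)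
    (m : ℕ∞) : ContDiffOn ℝ m (series n a) (Ici 0) := by
  refine contDiffOn_of_differentiableOn_deriv fun k _ => ?_
  refine DifferentiableOn.congr (fun x hx => ?_) (ha.iteratedDerivWithin_series n hn k)
  have hx0 : (0 : ℝ) ≤ x := hx
  exact (((ha.fwdDiff_iter k).hasDerivAt_series (n + k) (by omega)
    (x := x) (by linarith)).const_mul _).differentiableAt.differentiableWithinAt

/-! ### Images of the powers `(t - c)^i` -/

/-- The polynomial `V_n (t - c)^i`, for a constant `c`; see `hasSum_momentPoly`. -/
noncomputable def momentPoly (n : ℕ) (c : ℝ) : ℕ → ℝ[X]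
  | 0 => 1
  | i + 1 => (X - C c) * momentPoly n c i
      + C (n : ℝ)⁻¹ * (X * (1 + X) * derivative (momentPoly n c i))

theorem hasSum_momentPoly (n : ℕ) (hn : 1 ≤ n) (c : ℝ) (i : ℕ) {x : ℝ} (hx : 0 ≤ x) :
    HasSum (fun k : ℕ => ((k : ℝ) / n - c) ^ i * basis n k x) ((momentPoly n c i).eval x) := by
  induction i generalizing x with
  | zero => simpa [momentPoly] using hasSum_basis n hn x hx
  | succ i ih =>
    have hn' : (n : ℝ) ≠ 0 := by positivity
    have hx' : -(1 / 4) < x := by linarith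
    have ha := polyGrowth_node_sub_pow n hn c i
    have hd := (ha.hasDerivAt_series n hn hx').hasDerivWithinAt (s := Ici 0)
    -- the derivative of the series is that of the polynomial with which it agrees on `[0, ∞)`
    have hd' : HasDerivWithinAt (series n fun k : ℕ => ((k : ℝ) / n - c) ^ i)
        ((derivative (momentPoly n c i)).eval x) (Ici 0) x :=
      ((momentPoly n c i).hasDerivAt x).hasDerivWithinAt.congr
        (fun y hy => (ih hy).tsum_eq) (ih hx).tsum_eq
    have e := (uniqueDiffOn_Ici (0 : ℝ) x hx).eq_deriv _ hd hd'
    have h := ha.hasSum_mul_sub n hn hx'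
    rw [e] at h
    have h2 := (h.mul_left (n : ℝ)⁻¹).add ((ih hx).mul_left (x - c))
    have e2 : (momentPoly n c (i + 1)).eval x
        = (n : ℝ)⁻¹ * (x * (1 + x) * (derivative (momentPoly n c i)).eval x)
          + (x - c) * (momentPoly n c i).eval x := by
      simp only [momentPoly, eval_add, eval_mul, eval_sub, eval_X, eval_C, eval_one]
      ring
    rw [e2]
    refine h2.congr_fun fun k => ?_
    rw [pow_succ]
    generalize ((k : ℝ) / n - c) ^ i = z
    field_simp
    ring

theorem natDegree_momentPoly (n : ℕ) (c : ℝ) (i : ℕ) : (momentPoly n c i).natDegree ≤ i := by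
  induction i with
  | zero => simp [momentPoly]
  | succ i ih =>
    refine natDegree_add_le_of_degree_le ?_ ?_
    · refine natDegree_mul_le.trans ?_
      rw [natDegree_X_sub_C]
      omega
    · refine (natDegree_C_mul_le _ _).trans ?_
      rcases Nat.eq_zero_or_pos i with rfl | hi
      · simp [momentPoly]
      · have h1 := natDegree_derivative_le (momentPoly n c i)
        have h2 : (X * (1 + X) : ℝ[X]).natDegree ≤ 2 := by
          compute_degree
        exact natDegree_mul_le.trans (by omega)

theorem iterate_derivative_X_sub_C_mul (c : ℝ) (P : ℝ[X]) (k : ℕ) :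
    derivative^[k] ((X - C c) * P)
      = (X - C c) * derivative^[k] P + C (k : ℝ) * derivative^[k - 1] P := by
  induction k with
  | zero => simp
  | succ k ih =>
    rw [Function.iterate_succ_apply', ih, Function.iterate_succ_apply']
    rcases k with _ | k
    · simp
      ring
    · simp only [Nat.add_sub_cancel, derivative_add, derivative_mul, derivative_sub, derivative_X,
        derivative_C, Function.iterate_succ_apply']
      push_cast
      simp only [map_add, map_one]
      ring

/-- The derivatives at `c` of the polynomials `V_n (t - c)^i` satisfy a scalar recurrence. -/
theorem iterate_derivative_momentPoly_succ_eval (n : ℕ) (c : ℝ) (i k : ℕ) :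
    (derivative^[k] (momentPoly n c (i + 1))).eval c
      = k * (derivative^[k - 1] (momentPoly n c i)).eval c
        + (n : ℝ)⁻¹ * (c * (1 + c) * (derivative^[k + 1] (momentPoly n c i)).eval c
          + k * (1 + 2 * c) * (derivative^[k] (momentPoly n c i)).eval c
          + k * (k - 1) * (derivative^[k - 1] (momentPoly n c i)).eval c) := by
  set P := momentPoly n c i
  have e : momentPoly n c (i + 1) = (X - C c) * P + C (n : ℝ)⁻¹ *
      (C (c * (1 + c)) * derivative P + C (1 + 2 * c) * ((X - C c) * derivative P)
        + (X - C c) * ((X - C c) * derivative P)) := by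
    simp only [momentPoly, P, map_mul, map_add, map_one, map_ofNat]
    ring
  rw [e]
  simp only [iterate_map_add, iterate_derivative_C_mul, iterate_derivative_X_sub_C_mul,
    eval_add, eval_mul, eval_sub, eval_C, eval_X, sub_self, zero_mul, zero_add,
    ← Function.iterate_succ_apply derivative]
  rcases k with _ | _ | k
  · simp
  · simp
  · simp only [Nat.add_sub_cancel, Nat.succ_eq_add_one, show k + 1 + 1 - 1 = k + 1 by omega]
    push_cast
    ring

/-- The `k`-th derivative of `V_n (t - c)^i` at `c` has order `n^{-⌈(i-k)/2⌉}`; for `k = 0` this is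
the classical bound on the central moments. -/
theorem exists_iterate_derivative_momentPoly_bound (c : ℝ) (i k : ℕ) :
    ∃ B : ℝ, 0 ≤ B ∧ ∀ n : ℕ, 1 ≤ n →
      |(derivative^[k] (momentPoly n c i)).eval c| ≤ B * ((n : ℝ)⁻¹) ^ ((i + 1 - k) / 2) := by
  induction i generalizing k with
  | zero =>
    refine ⟨1, zero_le_one, fun n hn => ?_⟩
    rw [show (0 + 1 - k) / 2 = 0 by omega]
    rcases k with _ | k
    · simp [momentPoly]
    · simp [momentPoly]
  | succ i ih =>
    obtain ⟨A, hA, hA'⟩ := ih (k - 1)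
    obtain ⟨B, hB, hB'⟩ := ih k
    obtain ⟨D, hD, hD'⟩ := ih (k + 1)
    refine ⟨k * A + (|c * (1 + c)| * D + |k * (1 + 2 * c)| * B + |(k : ℝ) * (k - 1)| * A),
      by positivity, fun n hn => ?_⟩
    have hε0 : 0 ≤ (n : ℝ)⁻¹ := by positivity
    have hε1 : (n : ℝ)⁻¹ ≤ 1 := inv_le_one_of_one_le₀ (by exact_mod_cast hn)
    set ε := (n : ℝ)⁻¹ with hε
    have hA1 : k * |(derivative^[k - 1] (momentPoly n c i)).eval c|
        ≤ k * (A * ε ^ ((i + 1 + 1 - k) / 2)) := by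
      rcases Nat.eq_zero_or_pos k with rfl | hk
      · simp
      · rw [show i + 1 + 1 - k = i + 1 - (k - 1) by omega]
        exact mul_le_mul_of_nonneg_left (hA' n hn) (by positivity)
    have hmono : ∀ {K v : ℝ} {e : ℕ}, 0 ≤ K → |v| ≤ K * ε ^ e → (i + 1 + 1 - k) / 2 ≤ e + 1 →
        ε * |v| ≤ K * ε ^ ((i + 1 + 1 - k) / 2) := by
      intro K v e hK hv he
      calc ε * |v| ≤ ε * (K * ε ^ e) := mul_le_mul_of_nonneg_left hv hε0
        _ = K * ε ^ (e + 1) := by ring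
        _ ≤ _ := mul_le_mul_of_nonneg_left (pow_le_pow_of_le_one hε0 hε1 he) hK
    have h1 := hmono hD (hD' n hn) (by omega)
    have h2 := hmono hB (hB' n hn) (by omega)
    have h3 := hmono hA (hA' n hn) (by omega)
    rw [iterate_derivative_momentPoly_succ_eval]
    calc _ ≤ k * |(derivative^[k - 1] (momentPoly n c i)).eval c|
          + (|c * (1 + c)| * (ε * |(derivative^[k + 1] (momentPoly n c i)).eval c|)
            + |k * (1 + 2 * c)| * (ε * |(derivative^[k] (momentPoly n c i)).eval c|)
            + |(k : ℝ) * (k - 1)| * (ε * |(derivative^[k - 1] (momentPoly n c i)).eval c|)) := by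
          refine (abs_add_le _ _).trans (add_le_add ?_ ?_)
          · rw [abs_mul, Nat.abs_cast]
          · rw [abs_mul, abs_of_nonneg hε0]
            refine (mul_le_mul_of_nonneg_left (abs_add_three _ _ _) hε0).trans (le_of_eq ?_)
            rw [abs_mul (c * (1 + c)), abs_mul (k * (1 + 2 * c)), abs_mul ((k : ℝ) * (k - 1))]
            ring
      _ ≤ k * (A * ε ^ ((i + 1 + 1 - k) / 2))
          + (|c * (1 + c)| * (D * ε ^ ((i + 1 + 1 - k) / 2))
            + |k * (1 + 2 * c)| * (B * ε ^ ((i + 1 + 1 - k) / 2))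
            + |(k : ℝ) * (k - 1)| * (A * ε ^ ((i + 1 + 1 - k) / 2))) := by
          gcongr
      _ = _ := by ring

theorem tendsto_iterate_derivative_momentPoly (c : ℝ) (i k : ℕ) :
    Tendsto (fun n : ℕ => (derivative^[k] (momentPoly n c i)).eval c) atTop
      (𝓝 (if i = k then (k ! : ℝ) else 0)) := by
  have hinv : Tendsto (fun n : ℕ => (n : ℝ)⁻¹) atTop (𝓝 0) := tendsto_inv_atTop_nhds_zero_nat
  have hvanish : ∀ n i k : ℕ, i < k → derivative^[k] (momentPoly n c i) = 0 := fun n i k h =>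
    iterate_derivative_eq_zero ((natDegree_momentPoly n c i).trans_lt h)
  rcases lt_trichotomy i k with h | rfl | h
  · simp [hvanish _ i k h, h.ne]
  · rw [if_pos rfl]
    induction i with
    | zero => simp [momentPoly]
    | succ i ih =>
      have e : ∀ n, (derivative^[i + 1] (momentPoly n c (i + 1))).eval c
          = ((i : ℝ) + 1) * (derivative^[i] (momentPoly n c i)).eval c
            + (n : ℝ)⁻¹ * (((i : ℝ) + 1) * i * (derivative^[i] (momentPoly n c i)).eval c) := by
        intro n
        rw [iterate_derivative_momentPoly_succ_eval, hvanish n i (i + 1 + 1) (by omega),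
          hvanish n i (i + 1) (by omega)]
        simp
      simp only [e]
      have := (ih.const_mul ((i : ℝ) + 1)).add (hinv.mul (ih.const_mul (((i : ℝ) + 1) * i)))
      simpa [Nat.factorial_succ] using this
  · rw [if_neg h.ne']
    obtain ⟨B, hB, hB'⟩ := exists_iterate_derivative_momentPoly_bound c i k
    refine squeeze_zero_norm' ?_ (by simpa using hinv.const_mul B)
    filter_upwards [eventually_ge_atTop 1] with n hn
    have hε1 : (n : ℝ)⁻¹ ≤ 1 := inv_le_one_of_one_le₀ (by exact_mod_cast hn)
    refine (hB' n hn).trans (mul_le_mul_of_nonneg_left ?_ hB)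
    simpa using pow_le_pow_of_le_one (by positivity) hε1 (show 1 ≤ (i + 1 - k) / 2 by omega)

/-! ### Estimates for a remainder that vanishes to high order -/

/-- A function on `[0, ∞)`, given with its successive derivatives `g 0, g 1, …, g N`, that vanishes
to order `N` at `c`: its derivatives obey the bounds of Taylor's theorem. -/
theorem abs_le_of_vanishing_derivs {g : ℕ → ℝ → ℝ} {N : ℕ} {c M : ℝ} (hc : 0 ≤ c)
    (hg : ∀ i < N, ∀ t, 0 ≤ t → HasDerivWithinAt (g i) (g (i + 1) t) (Ici 0) t)
    (h0 : ∀ i < N, g i c = 0) (hM : ∀ t, 0 ≤ t → |g N t| ≤ M) {i m : ℕ} (hi : i + m = N) {t : ℝ}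
    (ht : 0 ≤ t) : |g i t| ≤ M * |t - c| ^ m := by
  induction m generalizing i t with
  | zero =>
    obtain rfl : i = N := by omega
    simpa using hM t ht
  | succ m ih =>
    have hsub : uIcc c t ⊆ Ici 0 := fun s hs => le_trans (le_min hc ht) hs.1
    have hM0 : 0 ≤ M := (abs_nonneg _).trans (hM 0 le_rfl)
    have h := Convex.norm_image_sub_le_of_norm_hasDerivWithin_le (s := uIcc c t) (f := g i)
      (f' := g (i + 1)) (C := M * |t - c| ^ m) (x := c) (y := t)
      (fun s hs => (hg i (by omega) s (hsub hs)).mono hsub) (fun s hs => ?_) (convex_uIcc c t)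
      left_mem_uIcc right_mem_uIcc
    · rw [h0 i (by omega), sub_zero, Real.norm_eq_abs, Real.norm_eq_abs] at h
      rwa [pow_succ, ← mul_assoc]
    · refine (ih (i := i + 1) (by omega) (hsub hs)).trans ?_
      have : |s - c| ≤ |t - c| := abs_sub_left_of_mem_uIcc hs
      gcongr

/-- A `k`-th difference of step `h = 1/n` is at most `h^k` times the supremum of the `k`-th
derivative. -/
theorem abs_fwdDiff_iter_le {G : ℕ → ℝ → ℝ} {n k : ℕ} {B : ℝ} (j : ℕ)
    (hG : ∀ i < k, ∀ t, 0 ≤ t → HasDerivWithinAt (G i) (G (i + 1) t) (Ici 0) t)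
    (hB : ∀ s ∈ Icc ((j : ℝ) / n) (((j : ℝ) + k) / n), |G k s| ≤ B) :
    |(fwdDiff 1)^[k] (fun j : ℕ => G 0 ((j : ℝ) / n)) j| ≤ ((n : ℝ)⁻¹) ^ k * B := by
  induction k generalizing G B with
  | zero =>
    have := hB ((j : ℝ) / n) (by simp)
    simpa using this
  | succ k ih =>
    set h : ℝ := (n : ℝ)⁻¹ with hh
    have hh0 : 0 ≤ h := by positivity
    have e : fwdDiff 1 (fun j : ℕ => G 0 ((j : ℝ) / n))
        = fun j : ℕ => (fun i t => G i (t + h) - G i t) 0 ((j : ℝ) / n) := by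
      funext j
      simp only [fwdDiff, hh]
      congr 2
      push_cast
      ring
    rw [Function.iterate_succ_apply, e]
    refine (ih (G := fun i t => G i (t + h) - G i t) (B := h * B) (fun i hi t ht => ?_)
      (fun s hs => ?_)).trans (le_of_eq (by ring))
    · have h1 := (hG i (by omega) (t + h) (by positivity)).comp t
        (((hasDerivAt_id t).add_const h).hasDerivWithinAt (s := Ici 0))
        (fun s hs => add_nonneg hs hh0)
      rw [mul_one] at h1
      exact h1.sub (hG i (by omega) t ht)
    · have hj : 0 ≤ (j : ℝ) / n := by positivity
      have hs0 : 0 ≤ s := hj.trans hs.1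
      have hsub : Icc s (s + h) ⊆ Ici 0 := fun y hy => hs0.trans hy.1
      have h2 := Convex.norm_image_sub_le_of_norm_hasDerivWithin_le (s := Icc s (s + h)) (f := G k)
        (f' := G (k + 1)) (C := B) (x := s) (y := s + h)
        (fun y hy => (hG k (by omega) y (hsub hy)).mono hsub) (fun y hy => ?_)
        (convex_Icc _ _) (by simp [hh0]) (by simp [hh0])
      · rw [add_sub_cancel_left, Real.norm_eq_abs, Real.norm_eq_abs, abs_of_nonneg hh0] at h2
        linarith
      · refine hB y ⟨hs.1.trans hy.1, hy.2.trans ?_⟩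
        have := hs.2
        rw [div_eq_mul_inv, ← hh] at this ⊢
        push_cast
        linarith

theorem basis_nonneg (n k : ℕ) {x : ℝ} (hx : 0 ≤ x) : 0 ≤ basis n k x := by
  unfold basis
  positivity

/-- Comparison of the points between the nodes `j/n` and `(j+k)/n` with the node `j/(n+k)`. -/
theorem abs_sub_le_of_mem_Icc_node {n j k : ℕ} (hn : 1 ≤ n) {c s : ℝ} (hc : 0 ≤ c)
    (hs : s ∈ Icc ((j : ℝ) / n) (((j : ℝ) + k) / n)) :
    |s - c| ≤ (1 + k) * (1 + c) * (|(j : ℝ) / (n + k : ℕ) - c| + (n : ℝ)⁻¹) := by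
  have hn0 : (0 : ℝ) < n := by positivity
  have hε1 : (n : ℝ)⁻¹ ≤ 1 := inv_le_one_of_one_le₀ (by exact_mod_cast hn)
  have hε0 : 0 ≤ (n : ℝ)⁻¹ := by positivity
  have hk : (0 : ℝ) ≤ k := by positivity
  set u : ℝ := (j : ℝ) / (n + k : ℕ) with hu
  have hu0 : 0 ≤ u := by positivity
  have hju : (j : ℝ) / n = u + u * k * (n : ℝ)⁻¹ := by
    rw [hu]
    push_cast
    field_simp
  have h1 : s ≤ u + u * k * (n : ℝ)⁻¹ + k * (n : ℝ)⁻¹ := by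
    have := hs.2
    rwa [add_div, hju, div_eq_mul_inv] at this
  have h2 : u ≤ s := by
    have := hs.1
    rw [hju] at this
    have h3 : 0 ≤ u * k * (n : ℝ)⁻¹ := by positivity
    linarith
  have h3 : |s - c| ≤ |u - c| + (u + 1) * k * (n : ℝ)⁻¹ := by
    have : |s - u| ≤ (u + 1) * k * (n : ℝ)⁻¹ := by
      rw [abs_of_nonneg (by linarith)]
      linarith
    have h4 := abs_sub_le s u c
    linarith
  have h4 : u ≤ |u - c| + c := by linarith [le_abs_self (u - c)]
  calc |s - c| ≤ |u - c| + (|u - c| + c + 1) * k * (n : ℝ)⁻¹ := by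
        refine h3.trans ?_
        gcongr
    _ = |u - c| * (1 + k * (n : ℝ)⁻¹) + (1 + c) * k * (n : ℝ)⁻¹ := by ring
    _ ≤ |u - c| * ((1 + k) * (1 + c)) + (1 + c) * (1 + k) * (n : ℝ)⁻¹ := by
        gcongr
        · nlinarith [mul_le_mul_of_nonneg_left hε1 hk]
        · linarith
    _ = _ := by ring

theorem ascFactorial_mul_inv_pow_le (n k : ℕ) (hn : 1 ≤ n) :
    (n.ascFactorial k : ℝ) * ((n : ℝ)⁻¹) ^ k ≤ k ! := by
  have hn0 : (n : ℝ) ≠ 0 := by positivity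
  have h : (n.ascFactorial k : ℝ) ≤ k ! * (n : ℝ) ^ k := by
    exact_mod_cast Nat.ascFactorial_le_factorial_mul_pow n k
  calc _ ≤ k ! * (n : ℝ) ^ k * ((n : ℝ)⁻¹) ^ k := by gcongr
    _ = _ := by rw [mul_assoc, ← mul_pow, mul_inv_cancel₀ hn0, one_pow, mul_one]

/-- If `g` vanishes to order `N` at `c` and its `N`-th derivative is bounded, then
`D^k (V_n g)(c)` has order `n^{-⌊(N-k)/2⌋}`: the `k`-th differences of `g` are controlled by powers
of the distance of the nodes from `c`, and these are averaged by the central moments. -/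
theorem exists_iteratedDerivWithin_series_bound {g : ℕ → ℝ → ℝ} {N : ℕ} {c M : ℝ} (hc : 0 ≤ c)
    (hg : ∀ i < N, ∀ t, 0 ≤ t → HasDerivWithinAt (g i) (g (i + 1) t) (Ici 0) t)
    (h0 : ∀ i < N, g i c = 0) (hM : ∀ t, 0 ≤ t → |g N t| ≤ M)
    (hgrowth : ∀ n : ℕ, 1 ≤ n → PolyGrowth (fun j : ℕ => g 0 ((j : ℝ) / n)))
    {k : ℕ} (hk : k ≤ N) :
    ∃ K : ℝ, ∀ n : ℕ, 1 ≤ n →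
      |iteratedDerivWithin k (series n fun j : ℕ => g 0 ((j : ℝ) / n)) (Ici 0) c|
        ≤ K * ((n : ℝ)⁻¹) ^ ((N - k) / 2) := by
  set e := N - k with he
  set d := e / 2 with hd
  have hM0 : 0 ≤ M := (abs_nonneg _).trans (hM 0 le_rfl)
  obtain ⟨A, hA, hA'⟩ := exists_iterate_derivative_momentPoly_bound c (2 * d) 0
  obtain ⟨B, hB, hB'⟩ := exists_iterate_derivative_momentPoly_bound c (2 * d + 2) 0
  set L : ℝ := (1 + k) * (1 + c) with hL
  have hL0 : 0 ≤ L := by positivity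
  refine ⟨k ! * (M * (L ^ e * 2 ^ (e - 1)) * (A + B + 1)), fun n hn => ?_⟩
  have hε0 : 0 ≤ (n : ℝ)⁻¹ := by positivity
  have hε1 : (n : ℝ)⁻¹ ≤ 1 := inv_le_one_of_one_le₀ (by exact_mod_cast hn)
  have hδ : ((n + k : ℕ) : ℝ)⁻¹ ≤ (n : ℝ)⁻¹ := by
    refine inv_anti₀ (by positivity) ?_
    push_cast
    linarith [(Nat.cast_nonneg k : (0 : ℝ) ≤ k)]
  have hδ0 : 0 ≤ ((n + k : ℕ) : ℝ)⁻¹ := by positivity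
  set ε := (n : ℝ)⁻¹ with hε
  -- odd absolute moments are dominated by the two neighbouring even ones
  have hpow : ∀ y : ℝ, |y| ^ e ≤ y ^ (2 * d) + y ^ (2 * d + 2) := by
    intro y
    rcases Nat.even_or_odd' e with ⟨m, hm | hm⟩
    · have : d = m := by omega
      rw [this, hm, (even_two_mul m).pow_abs]
      have : 0 ≤ y ^ (2 * m + 2) := Even.pow_nonneg ⟨m + 1, by ring⟩ y
      linarith
    · have : d = m := by omega
      rw [this, hm, pow_succ, (even_two_mul m).pow_abs, pow_add y]
      have h1 : 0 ≤ y ^ (2 * m) := (even_two_mul m).pow_nonneg y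
      have h2 : |y| ≤ 1 + y ^ 2 := by
        rw [← sq_abs y]
        nlinarith [sq_nonneg (|y| - 1), abs_nonneg y]
      nlinarith
  have hdiff : ∀ j : ℕ, |(fwdDiff 1)^[k] (fun j : ℕ => g 0 ((j : ℝ) / n)) j|
      ≤ ε ^ k * (M * (L ^ e * 2 ^ (e - 1))) * (((j : ℝ) / (n + k : ℕ) - c) ^ (2 * d)
        + ((j : ℝ) / (n + k : ℕ) - c) ^ (2 * d + 2) + ε ^ d * 1) := by
    intro j
    refine (abs_fwdDiff_iter_le (B := M * (L ^ e * 2 ^ (e - 1))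
      * (((j : ℝ) / (n + k : ℕ) - c) ^ (2 * d)
        + ((j : ℝ) / (n + k : ℕ) - c) ^ (2 * d + 2) + ε ^ d * 1)) j
      (fun i hi => hg i (by omega)) fun s hs => ?_).trans (le_of_eq (by ring))
    have hs0 : 0 ≤ s := le_trans (by positivity) hs.1
    refine (abs_le_of_vanishing_derivs hc hg h0 hM (m := e) (by omega) hs0).trans ?_
    rw [mul_assoc M]
    refine mul_le_mul_of_nonneg_left ?_ hM0
    calc |s - c| ^ e ≤ (L * (|(j : ℝ) / (n + k : ℕ) - c| + ε)) ^ e :=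
          pow_le_pow_left₀ (abs_nonneg _) (abs_sub_le_of_mem_Icc_node hn hc hs) e
      _ = L ^ e * (|(j : ℝ) / (n + k : ℕ) - c| + ε) ^ e := mul_pow _ _ _
      _ ≤ L ^ e * (2 ^ (e - 1) * (|(j : ℝ) / (n + k : ℕ) - c| ^ e + ε ^ e)) := by
          gcongr
          exact add_pow_le (abs_nonneg _) hε0 e
      _ ≤ L ^ e * (2 ^ (e - 1) * ((((j : ℝ) / (n + k : ℕ) - c) ^ (2 * d)
          + ((j : ℝ) / (n + k : ℕ) - c) ^ (2 * d + 2)) + ε ^ d)) := by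
          gcongr L ^ e * (2 ^ (e - 1) * (?_ + ?_))
          · exact hpow _
          · exact pow_le_pow_of_le_one hε0 hε1 (by omega)
      _ = _ := by ring
  have hsum := (((hasSum_momentPoly (n + k) (by omega) c (2 * d) hc).add
    (hasSum_momentPoly (n + k) (by omega) c (2 * d + 2) hc)).add
    ((hasSum_basis (n + k) (by omega) c hc).mul_left (ε ^ d))).mul_left
      (ε ^ k * (M * (L ^ e * 2 ^ (e - 1))))
  have hbound : |series (n + k) ((fwdDiff 1)^[k] (fun j : ℕ => g 0 ((j : ℝ) / n))) c|
      ≤ ε ^ k * (M * (L ^ e * 2 ^ (e - 1))) * ((A + B + 1) * ε ^ d) := by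
    refine (Real.norm_eq_abs _).symm.le.trans ((tsum_of_norm_bounded hsum fun j => ?_).trans ?_)
    · rw [Real.norm_eq_abs, abs_mul, abs_of_nonneg (basis_nonneg _ _ hc)]
      refine (mul_le_mul_of_nonneg_right (hdiff j) (basis_nonneg _ _ hc)).trans (le_of_eq ?_)
      ring
    · refine mul_le_mul_of_nonneg_left ?_ (by positivity)
      have h1 := hA' (n + k) (by omega)
      have h2 := hB' (n + k) (by omega)
      rw [show (2 * d + 1 - 0) / 2 = d by omega] at h1
      rw [show (2 * d + 2 + 1 - 0) / 2 = d + 1 by omega] at h2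
      have h3 : ((n + k : ℕ) : ℝ)⁻¹ ^ d ≤ ε ^ d := pow_le_pow_left₀ hδ0 hδ d
      have h4 : ((n + k : ℕ) : ℝ)⁻¹ ^ (d + 1) ≤ ε ^ d :=
        (pow_le_pow_left₀ hδ0 hδ _).trans (pow_le_pow_of_le_one hε0 hε1 (by omega))
      have h5 := (le_abs_self _).trans (h1.trans (mul_le_mul_of_nonneg_left h3 hA))
      have h6 := (le_abs_self _).trans (h2.trans (mul_le_mul_of_nonneg_left h4 hB))
      simp only [Function.iterate_zero, id] at h5 h6
      linarith
  rw [(hgrowth n hn).iteratedDerivWithin_series n hn k hc]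
  simp only [abs_mul, Nat.abs_cast]
  calc _ ≤ (n.ascFactorial k : ℝ)
        * (ε ^ k * (M * (L ^ e * 2 ^ (e - 1))) * ((A + B + 1) * ε ^ d)) := by gcongr
    _ = (n.ascFactorial k : ℝ) * ε ^ k
        * (M * (L ^ e * 2 ^ (e - 1)) * ((A + B + 1) * ε ^ d)) := by ring
    _ ≤ k ! * (M * (L ^ e * 2 ^ (e - 1)) * ((A + B + 1) * ε ^ d)) := by
        gcongr
        exact ascFactorial_mul_inv_pow_le n k hn
    _ = _ := by ring

/-! ### Taylor expansion and the Voronovskaya limits -/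

theorem iteratedDerivWithin_polynomial (q : ℝ[X]) (k : ℕ) :
    EqOn (iteratedDerivWithin k (fun t => q.eval t) (Ici 0))
      (fun t => (derivative^[k] q).eval t) (Ici 0) := by
  induction k with
  | zero => intro x _; simp
  | succ k ih =>
    intro x hx
    rw [iteratedDerivWithin_succ, derivWithin_congr ih (ih hx), Function.iterate_succ_apply']
    exact ((derivative^[k] q).hasDerivAt x).hasDerivWithinAt.derivWithin
      (uniqueDiffOn_Ici 0 x hx)

/-- The polynomial `∑_{i < N} a_i / i! (X - c)^i`, whose derivatives of order `k < N` at `c`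
are `a_k`. -/
noncomputable def taylorPoly (a : ℕ → ℝ) (c : ℝ) (N : ℕ) : ℝ[X] :=
  ∑ i ∈ Finset.range N, C (a i / i !) * (X - C c) ^ i

/-- The polynomial `V_n` of `taylorPoly a c N`. -/
noncomputable def taylorImage (n : ℕ) (a : ℕ → ℝ) (c : ℝ) (N : ℕ) : ℝ[X] :=
  ∑ i ∈ Finset.range N, C (a i / i !) * momentPoly n c i

theorem iterate_derivative_taylorPoly_eval (a : ℕ → ℝ) (c : ℝ) {N k : ℕ} (hk : k < N) :
    (derivative^[k] (taylorPoly a c N)).eval c = a k := by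
  rw [taylorPoly, iterate_derivative_sum, eval_finsetSum,
    Finset.sum_eq_single_of_mem k (Finset.mem_range.2 hk)]
  · rw [iterate_derivative_C_mul, iterate_derivative_X_sub_pow_self]
    have : (k ! : ℝ) ≠ 0 := by positivity
    simp
    field_simp
  · intro i _ hi
    rw [iterate_derivative_C_mul, iterate_derivative_X_sub_pow]
    rcases lt_or_gt_of_ne hi with h | h
    · simp [Nat.descFactorial_of_lt h]
    · simp [show i - k ≠ 0 by omega]

theorem iterate_derivative_taylorPoly (a : ℕ → ℝ) (c : ℝ) (N : ℕ) :
    derivative^[N] (taylorPoly a c N) = 0 := by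
  rw [taylorPoly, iterate_derivative_sum]
  refine Finset.sum_eq_zero fun i hi => ?_
  rw [iterate_derivative_C_mul, iterate_derivative_X_sub_pow,
    Nat.descFactorial_of_lt (Finset.mem_range.1 hi)]
  simp

theorem polyGrowth_taylorPoly (n : ℕ) (hn : 1 ≤ n) (a : ℕ → ℝ) (c : ℝ) (N : ℕ) :
    PolyGrowth (fun j : ℕ => (taylorPoly a c N).eval ((j : ℝ) / n)) := by
  simp only [taylorPoly, eval_finsetSum, eval_mul, eval_C, eval_pow, eval_sub, eval_X]
  exact PolyGrowth.sum _ fun i _ => (polyGrowth_node_sub_pow n hn c i).const_mul _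

theorem hasSum_taylorImage (n : ℕ) (hn : 1 ≤ n) (a : ℕ → ℝ) (c : ℝ) (N : ℕ) {x : ℝ} (hx : 0 ≤ x) :
    HasSum (fun j : ℕ => (taylorPoly a c N).eval ((j : ℝ) / n) * basis n j x)
      ((taylorImage n a c N).eval x) := by
  simp only [taylorPoly, taylorImage, eval_finsetSum, eval_mul, eval_C, eval_pow, eval_sub, eval_X,
    Finset.sum_mul, mul_assoc]
  exact hasSum_sum fun i _ => (hasSum_momentPoly n hn c i hx).mul_left _

/-- `U_n V_n p = p` at `c`, for the polynomial `p = taylorPoly a c N`. -/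
theorem sum_eta_mul_taylorImage (n : ℕ) (hn : 1 ≤ n) (a : ℕ → ℝ) (c : ℝ) {N : ℕ} (hN : 0 < N) :
    ∑ k ∈ Finset.range N, (eta n k).eval c * (derivative^[k] (taylorImage n a c N)).eval c
      = a 0 := by
  have h := (diffOp_eta_eq n hn (taylorPoly a c N)).2 (taylorImage n a c N)
    fun x hx => (hasSum_taylorImage n hn a c N hx).tsum_eq
  have hdeg : (taylorImage n a c N).natDegree < N := by
    refine lt_of_le_of_lt (natDegree_sum_le_of_forall_le (n := N - 1) _ _ fun i hi => ?_)
      (by omega)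
    have := Finset.mem_range.1 hi
    exact (natDegree_C_mul_le _ _).trans ((natDegree_momentPoly n c i).trans (by omega))
  rw [diffOp_eq _ _ N hdeg] at h
  have h0 := iterate_derivative_taylorPoly_eval a c hN
  rw [Function.iterate_zero, id, ← h, eval_finsetSum] at h0
  simpa using h0

theorem tendsto_iterate_derivative_taylorImage (a : ℕ → ℝ) (c : ℝ) {N k : ℕ} (hk : k < N) :
    Tendsto (fun n : ℕ => (derivative^[k] (taylorImage n a c N)).eval c) atTop (𝓝 (a k)) := by
  have e : a k = ∑ i ∈ Finset.range N, a i / i ! * (if i = k then (k ! : ℝ) else 0) := by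
    rw [Finset.sum_eq_single_of_mem k (Finset.mem_range.2 hk)]
    · have : (k ! : ℝ) ≠ 0 := by positivity
      simp
      field_simp
    · intro i _ hi
      simp [hi]
  rw [e]
  simp only [taylorImage, iterate_derivative_sum, eval_finsetSum, iterate_derivative_C_mul,
    eval_mul, eval_C]
  exact tendsto_finsetSum _ fun i _ =>
    (tendsto_iterate_derivative_momentPoly c i k).const_mul _

/-- The orders of `η_k` and of the `k`-th derivative of the remainder add up to `n^{-(r+2)}`. -/
theorem tendsto_eta_mul_remainder (c K : ℝ) {r k : ℕ} (hk : k ≤ 2 * r + 1) {E : ℕ → ℝ}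
    (hE : ∀ n : ℕ, 1 ≤ n → |E n| ≤ K * ((n : ℝ)⁻¹) ^ ((2 * r + 4 - k) / 2)) :
    Tendsto (fun n : ℕ => (n : ℝ) ^ (r + 1) * ((eta n k).eval c * E n)) atTop (𝓝 0) := by
  have hinv : Tendsto (fun n : ℕ => (n : ℝ)⁻¹) atTop (𝓝 0) := tendsto_inv_atTop_nhds_zero_nat
  have h := ((tendsto_eta c k).abs.mul_const K).mul hinv
  rw [mul_zero] at h
  refine squeeze_zero_norm' ?_ h
  filter_upwards [eventually_ge_atTop 1] with n hn
  have hn0 : (n : ℝ) ≠ 0 := by positivity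
  obtain ⟨m, hm⟩ : ∃ m, r + 1 = (k + 1) / 2 + m := ⟨r + 1 - (k + 1) / 2, by omega⟩
  have hm' : (2 * r + 4 - k) / 2 = m + 1 := by omega
  have hE' := hE n hn
  rw [hm'] at hE'
  calc ‖(n : ℝ) ^ (r + 1) * ((eta n k).eval c * E n)‖
      = |(n : ℝ) ^ ((k + 1) / 2) * (eta n k).eval c| * ((n : ℝ) ^ m * |E n|) := by
        rw [hm, pow_add, Real.norm_eq_abs, abs_mul, abs_mul, abs_mul, abs_mul,
          abs_of_nonneg (show (0 : ℝ) ≤ (n : ℝ) ^ m by positivity)]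
        ring
    _ ≤ |(n : ℝ) ^ ((k + 1) / 2) * (eta n k).eval c|
          * ((n : ℝ) ^ m * (K * ((n : ℝ)⁻¹) ^ (m + 1))) := by gcongr
    _ = |(n : ℝ) ^ ((k + 1) / 2) * (eta n k).eval c| * K * (n : ℝ)⁻¹
          * ((n : ℝ) * (n : ℝ)⁻¹) ^ m := by
        rw [mul_pow]
        ring
    _ = _ := by rw [mul_inv_cancel₀ hn0, one_pow, mul_one]

theorem tendsto_eta_mul_main (c : ℝ) {r k : ℕ} (hk : 2 * r + 1 ≤ k) {D : ℕ → ℝ} {a : ℝ}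
    (hD : Tendsto D atTop (𝓝 a)) :
    Tendsto (fun n : ℕ => (n : ℝ) ^ (r + 1) * ((eta n k).eval c * D n)) atTop
      (𝓝 (if k ≤ 2 * r + 2 then etaBar k c * a else 0)) := by
  have h := (tendsto_eta c k).mul hD
  split_ifs with hk'
  · rw [show (k + 1) / 2 = r + 1 by omega] at h
    exact h.congr fun n => by ring
  · obtain ⟨m, hm⟩ : ∃ m, (k + 1) / 2 = r + 1 + (m + 1) := ⟨(k + 1) / 2 - (r + 2), by omega⟩
    have hinv : Tendsto (fun n : ℕ => ((n : ℝ)⁻¹) ^ (m + 1)) atTop (𝓝 0) := by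
      simpa using (tendsto_inv_atTop_nhds_zero_nat (𝕜 := ℝ)).pow (m + 1)
    have h2 := hinv.mul h
    rw [zero_mul] at h2
    refine h2.congr' ?_
    filter_upwards [eventually_ge_atTop 1] with n hn
    have hn0 : (n : ℝ) ≠ 0 := by positivity
    rw [hm, pow_add (n : ℝ)]
    calc _ = ((n : ℝ) * (n : ℝ)⁻¹) ^ (m + 1) * ((n : ℝ) ^ (r + 1) * ((eta n k).eval c * D n)) := by
          rw [mul_pow]
          ring
      _ = _ := by rw [mul_inv_cancel₀ hn0, one_pow, one_mul]

/-- The derivatives of the remainder of `f` after its Taylor polynomial of degree `N - 1` at `c`. -/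
noncomputable def taylorRemainder (f : ℝ → ℝ) (c : ℝ) (N i : ℕ) (t : ℝ) : ℝ :=
  iteratedDerivWithin i f (Ici 0) t
    - (derivative^[i] (taylorPoly (fun j => iteratedDerivWithin j f (Ici 0) c) c N)).eval t

section Remainder

variable {f : ℝ → ℝ} {N : ℕ} {M c : ℝ}

theorem hasDerivWithinAt_taylorRemainder (hf : ContDiffOn ℝ N f (Ici 0)) (c : ℝ) {i : ℕ}
    (hi : i < N) {t : ℝ} (ht : 0 ≤ t) :
    HasDerivWithinAt (taylorRemainder f c N i) (taylorRemainder f c N (i + 1) t) (Ici 0) t := by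
  have h := (hf.differentiableOn_iteratedDerivWithin (m := i) (by exact_mod_cast hi)
    (uniqueDiffOn_Ici 0) t ht).hasDerivWithinAt
  rw [← iteratedDerivWithin_succ] at h
  refine h.sub ?_
  rw [Function.iterate_succ_apply']
  exact (Polynomial.hasDerivAt _ t).hasDerivWithinAt

theorem taylorRemainder_self {i : ℕ} (hi : i < N) : taylorRemainder f c N i c = 0 := by
  rw [taylorRemainder, iterate_derivative_taylorPoly_eval _ _ hi, sub_self]

theorem abs_taylorRemainder_le (hb : ∀ t, 0 ≤ t → |iteratedDerivWithin N f (Ici 0) t| ≤ M) {t : ℝ}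
    (ht : 0 ≤ t) : |taylorRemainder f c N N t| ≤ M := by
  rw [taylorRemainder, iterate_derivative_taylorPoly, eval_zero, sub_zero]
  exact hb t ht

theorem polyGrowth_taylorRemainder (hf : ContDiffOn ℝ N f (Ici 0))
    (hb : ∀ t, 0 ≤ t → |iteratedDerivWithin N f (Ici 0) t| ≤ M) (hc : 0 ≤ c) (n : ℕ) (hn : 1 ≤ n) :
    PolyGrowth (fun j : ℕ => taylorRemainder f c N 0 ((j : ℝ) / n)) := by
  have hM : 0 ≤ M := (abs_nonneg _).trans (hb 0 le_rfl)
  obtain ⟨C, d, h⟩ := (polyGrowth_node_sub_pow n hn c N).const_mul M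
  refine ⟨C, d, fun j => le_trans ?_ (h j)⟩
  rw [abs_mul, abs_of_nonneg hM, abs_pow]
  exact abs_le_of_vanishing_derivs hc
    (fun i hi t ht => hasDerivWithinAt_taylorRemainder hf c hi ht)
    (fun i hi => taylorRemainder_self hi) (fun t ht => abs_taylorRemainder_le hb ht)
    (zero_add N) (by positivity)

theorem taylorRemainder_add_taylorPoly (f : ℝ → ℝ) (c : ℝ) (N : ℕ) (t : ℝ) :
    taylorRemainder f c N 0 t
      + (taylorPoly (fun j => iteratedDerivWithin j f (Ici 0) c) c N).eval t = f t := by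
  simp [taylorRemainder]

theorem polyGrowth_nodes (hf : ContDiffOn ℝ N f (Ici 0))
    (hb : ∀ t, 0 ≤ t → |iteratedDerivWithin N f (Ici 0) t| ≤ M) (n : ℕ) (hn : 1 ≤ n) :
    PolyGrowth (fun j : ℕ => f ((j : ℝ) / n)) := by
  have := (polyGrowth_taylorRemainder hf hb le_rfl n hn).add
    (polyGrowth_taylorPoly n hn (fun j => iteratedDerivWithin j f (Ici 0) 0) 0 N)
  simpa only [taylorRemainder_add_taylorPoly] using this

theorem iteratedDerivWithin_op (hf : ContDiffOn ℝ N f (Ici 0))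
    (hb : ∀ t, 0 ≤ t → |iteratedDerivWithin N f (Ici 0) t| ≤ M) (hc : 0 ≤ c) (n : ℕ) (hn : 1 ≤ n)
    (k : ℕ) :
    iteratedDerivWithin k (op n f) (Ici 0) c
      = iteratedDerivWithin k (series n fun j : ℕ => taylorRemainder f c N 0 ((j : ℝ) / n))
          (Ici 0) c
        + (derivative^[k]
          (taylorImage n (fun j => iteratedDerivWithin j f (Ici 0) c) c N)).eval c := by
  have hR := polyGrowth_taylorRemainder hf hb hc n hn
  set q := taylorImage n (fun j => iteratedDerivWithin j f (Ici 0) c) c N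
  have e : EqOn (op n f)
      ((series n fun j : ℕ => taylorRemainder f c N 0 ((j : ℝ) / n)) + fun t => q.eval t)
      (Ici 0) := by
    intro x hx
    have hx0 : (0 : ℝ) ≤ x := hx
    have h := ((hR.summable n hn (x := x) (by linarith)).hasSum).add
      (hasSum_taylorImage n hn (fun j => iteratedDerivWithin j f (Ici 0) c) c N hx0)
    simp only [← add_mul, taylorRemainder_add_taylorPoly] at h
    exact h.tsum_eq
  have hcI : c ∈ Ici (0 : ℝ) := hc
  have hq' : ContDiff ℝ k fun t => q.eval t := by
    simpa only [coe_aeval_eq_eval] using Polynomial.contDiff_aeval (𝕜 := ℝ) q k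
  rw [iteratedDerivWithin_congr e hcI, iteratedDerivWithin_add hcI (uniqueDiffOn_Ici 0)
    ((hR.contDiffOn_series n hn k) c hcI) (hq'.contDiffOn c hcI),
    iteratedDerivWithin_polynomial q k hcI]

end Remainder

/-- Both Voronovskaya limits: with the left quasi-interpolant of order `s ∈ {2r, 2r + 1}`, the limit
collects the terms with `s < k ≤ 2r + 2`. -/
theorem tendsto_sub_quasiInterpolant {r s : ℕ} (hs : 2 * r ≤ s) (hs' : s ≤ 2 * r + 1) {f : ℝ → ℝ}
    {M c : ℝ} (hf : ContDiffOn ℝ ((2 * r + 4 : ℕ) : WithTop ℕ∞) f (Ici 0))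
    (hb : ∀ t, 0 ≤ t → |iteratedDerivWithin (2 * r + 4) f (Ici 0) t| ≤ M) (hc : 0 ≤ c) :
    Tendsto (fun n : ℕ => (n : ℝ) ^ (r + 1) * (f c - quasiInterpolant n s f c)) atTop
      (𝓝 (∑ k ∈ Finset.Ico (s + 1) (2 * r + 4),
        if k ≤ 2 * r + 2 then etaBar k c * iteratedDerivWithin k f (Ici 0) c else 0)) := by
  set a : ℕ → ℝ := fun j => iteratedDerivWithin j f (Ici 0) c with ha
  set E : ℕ → ℕ → ℝ := fun k n =>
    iteratedDerivWithin k (series n fun j : ℕ => taylorRemainder f c (2 * r + 4) 0 ((j : ℝ) / n))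
      (Ici 0) c with hE
  have hmain : Tendsto (fun n : ℕ => ∑ k ∈ Finset.Ico (s + 1) (2 * r + 4), (n : ℝ) ^ (r + 1) *
      ((eta n k).eval c * (derivative^[k] (taylorImage n a c (2 * r + 4))).eval c)) atTop
      (𝓝 (∑ k ∈ Finset.Ico (s + 1) (2 * r + 4),
        if k ≤ 2 * r + 2 then etaBar k c * a k else 0)) := by
    refine tendsto_finsetSum _ fun k hk => ?_
    rw [Finset.mem_Ico] at hk
    exact tendsto_eta_mul_main c (by omega) (tendsto_iterate_derivative_taylorImage a c hk.2)
  have hrem : Tendsto (fun n : ℕ => ∑ k ∈ Finset.range (s + 1), (n : ℝ) ^ (r + 1) *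
      ((eta n k).eval c * E k n)) atTop (𝓝 0) := by
    rw [← Finset.sum_const_zero (s := Finset.range (s + 1))]
    refine tendsto_finsetSum _ fun k hk => ?_
    rw [Finset.mem_range] at hk
    obtain ⟨K, hK⟩ := exists_iteratedDerivWithin_series_bound (k := k) hc
      (fun i hi t ht => hasDerivWithinAt_taylorRemainder hf c hi ht)
      (fun i hi => taylorRemainder_self hi) (fun t ht => abs_taylorRemainder_le hb ht)
      (fun n hn => polyGrowth_taylorRemainder hf hb hc n hn) (by omega)
    exact tendsto_eta_mul_remainder c K (by omega) hK
  have h := hmain.sub hrem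
  rw [sub_zero] at h
  refine h.congr' ?_
  filter_upwards [eventually_ge_atTop 1] with n hn
  have h1 := sum_eta_mul_taylorImage n hn a c (N := 2 * r + 4) (by omega)
  rw [← Finset.sum_range_add_sum_Ico _ (show s + 1 ≤ 2 * r + 4 by omega)] at h1
  have h0 : a 0 = f c := by simp [ha]
  have h2 : quasiInterpolant n s f c = ∑ k ∈ Finset.range (s + 1), (eta n k).eval c * E k n
      + ∑ k ∈ Finset.range (s + 1),
        (eta n k).eval c * (derivative^[k] (taylorImage n a c (2 * r + 4))).eval c := by
    rw [quasiInterpolant, ← Finset.sum_add_distrib]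
    refine Finset.sum_congr rfl fun k _ => ?_
    rw [iteratedDerivWithin_op hf hb hc n hn k, mul_add]
  rw [h2, ← h0, ← h1, ← Finset.mul_sum, ← Finset.mul_sum]
  ring

end Baskakov

theorem theorem5 (r : ℕ) (f : ℝ → ℝ)
    (hf : ContDiffOn ℝ ((2 * r + 4 : ℕ) : WithTop ℕ∞) f (Set.Ici 0))
    (hb : ∃ M : ℝ, ∀ t : ℝ, 0 ≤ t → |iteratedDerivWithin (2 * r + 4) f (Set.Ici 0) t| ≤ M) :
    (∀ n : ℕ, 1 ≤ n →
      (∀ x : ℝ, 0 ≤ x → Summable fun k : ℕ => f ((k : ℝ) / n) * Baskakov.basis n k x) ∧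
      ContDiffOn ℝ ((2 * r + 1 : ℕ) : WithTop ℕ∞) (Baskakov.op n f) (Set.Ici 0)) ∧
    ∀ x : ℝ, 0 ≤ x →
      Filter.Tendsto
        (fun n : ℕ => (n : ℝ) ^ (r + 1) * (f x - Baskakov.quasiInterpolant n (2 * r) f x))
        Filter.atTop
        (nhds (Baskakov.etaBar (2 * r + 1) x * iteratedDerivWithin (2 * r + 1) f (Set.Ici 0) x
          + Baskakov.etaBar (2 * r + 2) x * iteratedDerivWithin (2 * r + 2) f (Set.Ici 0) x)) ∧
      Filter.Tendsto
        (fun n : ℕ => (n : ℝ) ^ (r + 1) * (f x - Baskakov.quasiInterpolant n (2 * r + 1) f x))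
        Filter.atTop
        (nhds (Baskakov.etaBar (2 * r + 2) x * iteratedDerivWithin (2 * r + 2) f (Set.Ici 0) x)) := by
  obtain ⟨M, hb⟩ := hb
  refine ⟨fun n hn => ?_, fun x hx => ⟨?_, ?_⟩⟩
  · have ha := Baskakov.polyGrowth_nodes hf hb n hn
    exact ⟨fun x hx => ha.summable n hn (by linarith),
      ha.contDiffOn_series n hn ((2 * r + 1 : ℕ) : ℕ∞)⟩
  · have h := Baskakov.tendsto_sub_quasiInterpolant (s := 2 * r) le_rfl (by omega) hf hb hx
    simpa [Finset.sum_Ico_succ_top] using h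
  · have h := Baskakov.tendsto_sub_quasiInterpolant (s := 2 * r + 1) (by omega) le_rfl hf hb hx
    simpa [Finset.sum_Ico_succ_top] using h
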